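/- **Conventions.** Let $G$ be a discrete group with identity $e$. A *partial action* $\alpha=(\{A_g\}_{g\in G},\{\alpha_g\}_{g\in G})$ of $G$ on a C\*-algebra $A$ consists of closed two-sided ideals $A_g$ of $A$ and \*-isomorphisms $\alpha_g\colon A_{g^{-1}}\to A_g$ with $A_e=A$, $\alpha_e=\mathrm{id}_A$, and such that $\alpha_{gh}$ extends $\alpha_g\circ\alpha_h$ (whose domain is $\{x\in A_{h^{-1}}:\alpha_h(x)\in A_{g^{-1}}\}$) for all $g,h\in G$. The partial crossed product $A\rtimes_\alpha G$ is the completion of the \*-algebra of finite formal sums $\sum_g a_g\delta_g$, $a_g\in A_g$, with product $a\delta_g\cdot b\delta_h=\alpha_g(\alpha_{g^{-1}}(a)b)\delta_{gh}$ and involution $(a\delta_g)^*=\alpha_{g^{-1}}(a^*)\delta_{g^{-1}}$, in the supremum of all C\*-seminorms. The conditional expectation $E\colon A\rtimes_\alpha G\to A$ is the continuous linear map with $E(a\delta_g)=a$ if $g=e$ and $E(a\delta_g)=0$ if $g\ne e$. A \*-homomorphism $\phi\colon A\to B$ between C\*-algebras with partial actions $\alpha,\beta$ of $G$ is *$G$-equivariant*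 if $\phi(A_g)\subseteq B_g$ and $\phi\circ\alpha_g=\beta_g\circ\phi$ on $A_{g^{-1}}$ for all $g$; it induces the \*-homomorphism $A\rtimes_\alpha G\to B\rtimes_\beta G$, $a\delta_g\mapsto\phi(a)\delta_g$. A *tracial state* is a positive linear functional $\tau$ of norm one with $\tau(ab)=\tau(ba)$; it is *$G$-invariant* if $\tau(a)=\tau(\alpha_{g^{-1}}(a))$ for $g\in G$, $a\in A_g$. Inductive limits of sequences of C\*-algebras are taken in the category of C\*-algebras and \*-homomorphisms. An *inductive sequence of tracial states* on $(A^{(i)},\phi_i)_{i\in\mathbb N}$ consists of tracial states $\tau_i$ on $A^{(i)}$ with $\tau_{i+1}\circ\phi_i=\tau_i$, and its limit $\varinjlim\tau_i$ on an inductive limit $(A,(\mu_i)_i)$ is the tracial state $\tau$ on $A$ with $\tau\circ\mu_i=\tau_i$ for all $i$. **Proposition.** For $i\in\mathbb N$ let $\alpha^{(i)}$ be a partial action of $G$ on a C\*-algebra $A^{(i)}$ and $\phi_i\colon A^{(i)}\to A^{(i+1)}$ a $G$-equivariant \*-homomorphism. Let $(A,(\mu_i)_i)$ be an inductive limit of $(A^{(i)},\phi_i)_{i}$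 and let $\alpha$ be the inductive limit partial action of $G$ on $A$, that is, the partial action with $A_g=\overline{\bigcup_i\mu_i(A^{(i)}_g)}$ and $\alpha_g\circ\mu_i=\mu_i\circ\alpha^{(i)}_g$ on $A^{(i)}_{g^{-1}}$ for all $g\in G$ and all $i$. Let $\psi_i\colon A^{(i)}\rtimes_{\alpha^{(i)}}G\to A^{(i+1)}\rtimes_{\alpha^{(i+1)}}G$ and $\lambda_i\colon A^{(i)}\rtimes_{\alpha^{(i)}}G\to A\rtimes_\alpha G$ be the \*-homomorphisms induced by $\phi_i$ and $\mu_i$, and let $E$ and $E_i$ be the conditional expectations of $A\rtimes_\alpha G$ and $A^{(i)}\rtimes_{\alpha^{(i)}}G$. Let $(\tau_i)_i$ be an inductive sequence of $G$-invariant tracial states on $(A^{(i)},\phi_i)_{i}$. Then: 1. $(A\rtimes_\alpha G,(\lambda_i)_i)$ is an inductive limit of $(A^{(i)}\rtimes_{\alpha^{(i)}}G,\psi_i)_{i}$; 2. $(\tau_i\circ E_i)_i$ is an inductive sequence of tracial states on $(A^{(i)}\rtimes_{\alpha^{(i)}}G,\psi_i)_{i}$; 3. the limits $\varinjlim\tau_i$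 on $(A,(\mu_i)_i)$ and $\varinjlim(\tau_i\circ E_i)$ on $(A\rtimes_\alpha G,(\lambda_i)_i)$ exist and are unique; 4. $(\varinjlim\tau_i)\circ E=\varinjlim(\tau_i\circ E_i)$. -/

import Mathlib

universe u v

/-- A C⋆-seminorm on a complex ⋆-algebra: a submultiplicative, ⋆-invariant seminorm that
satisfies the C⋆-identity. -/
structure CStarSeminorm (R : Type*) [NonUnitalRing R] [StarRing R] [Module ℂ R] extends
    Seminorm ℂ R where
  mul_le' : ∀ x y : R, toFun (x * y) ≤ toFun x * toFun y
  star_eq' : ∀ x : R, toFun (star x) = toFun x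
  star_mul_self_eq' : ∀ x : R, toFun (star x * x) = toFun x ^ 2

namespace CStarSeminorm

set_option linter.unusedSectionVars false

open UniformSpace

section Completion

variable {R : Type*} [NonUnitalRing R] [StarRing R] [Module ℂ R]

/-- The ⋆-algebra `R`, seen as a space with the seminorm `p`. -/
def Carrier (_p : CStarSeminorm R) : Type _ := R

variable (p : CStarSeminorm R)

instance : NonUnitalRing p.Carrier := inferInstanceAs (NonUnitalRing R)

instance : StarRing p.Carrier := inferInstanceAs (StarRing R)

instance : Module ℂ p.Carrier := inferInstanceAs (Module ℂ R)

instance [IsScalarTower ℂ R R] : IsScalarTower ℂ p.Carrier p.Carrier :=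
  inferInstanceAs (IsScalarTower ℂ R R)

instance [SMulCommClass ℂ R R] : SMulCommClass ℂ p.Carrier p.Carrier :=
  inferInstanceAs (SMulCommClass ℂ R R)

instance [StarModule ℂ R] : StarModule ℂ p.Carrier := inferInstanceAs (StarModule ℂ R)

noncomputable instance : SeminormedAddCommGroup p.Carrier :=
  AddGroupSeminorm.toSeminormedAddCommGroup
    (E := p.Carrier) p.toSeminorm.toAddGroupSeminorm

noncomputable instance : NonUnitalSeminormedRing p.Carrier where
  __ := (inferInstance : SeminormedAddCommGroup p.Carrier)
  __ := (inferInstance : NonUnitalRing p.Carrier)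
  norm_mul_le := p.mul_le'

noncomputable instance : NormedSpace ℂ p.Carrier where
  norm_smul_le c x := (p.toSeminorm.smul' c x).le

instance : NormedStarGroup p.Carrier where
  norm_star_le x := (p.star_eq' x).le

/-- The Hausdorff completion of the ⋆-algebra `R` with respect to the C⋆-seminorm `p`. -/
def Compl : Type _ := Completion p.Carrier

noncomputable instance : NormedAddCommGroup p.Compl :=
  inferInstanceAs (NormedAddCommGroup (Completion p.Carrier))

noncomputable instance : NormedSpace ℂ p.Compl :=
  inferInstanceAs (NormedSpace ℂ (Completion p.Carrier))

instance : CompleteSpace p.Compl :=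
  inferInstanceAs (CompleteSpace (Completion p.Carrier))

/-- The canonical map from `R` to its completion, as a linear map. -/
noncomputable def toComplₗ : R →ₗ[ℂ] p.Compl :=
  (Completion.toComplₗᵢ (𝕜 := ℂ) (E := p.Carrier)).toLinearMap

lemma norm_toComplₗ (x : R) : ‖p.toComplₗ x‖ = p.toSeminorm x :=
  Completion.norm_coe (E := p.Carrier) x

lemma denseRange_toComplₗ : DenseRange p.toComplₗ :=
  Completion.denseRange_coe (α := p.Carrier)

/-- The multiplication of the completion, extending that of `R` by continuity. -/
noncomputable instance : Mul p.Compl where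
  mul := Function.curry <|
    (Completion.isDenseInducing_coe.prodMap Completion.isDenseInducing_coe).extend
      ((Completion.coe' (α := p.Carrier)) ∘
        Function.uncurry ((· * ·) : p.Carrier → p.Carrier → p.Carrier))

/-- The involution of the completion, extending that of `R` by continuity. -/
noncomputable instance : Star p.Compl where
  star := Completion.map (star : p.Carrier → p.Carrier)

lemma toComplₗ_mul (x y : R) : p.toComplₗ (x * y) = p.toComplₗ x * p.toComplₗ y :=
  ((Completion.isDenseInducing_coe.prodMap Completion.isDenseInducing_coe).extend_eq
      ((Completion.continuous_coe p.Carrier).comp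
        (continuous_mul (M := p.Carrier))) (x, y)).symm

lemma toComplₗ_star (x : R) : p.toComplₗ (star x) = star (p.toComplₗ x) :=
  (Completion.map_coe (f := (star : p.Carrier → p.Carrier))
    (star_isometry (E := p.Carrier)).uniformContinuous x).symm

instance : ContinuousMul p.Compl where
  continuous_mul := by
    let m := (AddMonoidHom.mul : p.Carrier →+ p.Carrier →+ p.Carrier).compr₂ Completion.toCompl
    have : Continuous fun q : p.Carrier × p.Carrier => m q.1 q.2 :=
      (Completion.continuous_coe p.Carrier).comp continuous_mul
    have di : IsDenseInducing (Completion.toCompl : p.Carrier → Completion p.Carrier) :=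
      Completion.isDenseInducing_coe
    exact (di.extend_Z_bilin di this :)

instance : ContinuousStar p.Compl where
  continuous_star := Completion.continuous_map (f := (star : p.Carrier → p.Carrier))

lemma compl_induction {P : p.Compl → Prop} (hP : IsClosed {x | P x})
    (h : ∀ x : R, P (p.toComplₗ x)) (x : p.Compl) : P x :=
  p.denseRange_toComplₗ.induction_on x hP h

lemma compl_induction₂ {P : p.Compl → p.Compl → Prop} (hP : IsClosed {x : p.Compl × p.Compl | P x.1 x.2})
    (h : ∀ x y : R, P (p.toComplₗ x) (p.toComplₗ y)) (x y : p.Compl) : P x y :=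
  (p.denseRange_toComplₗ.prodMap p.denseRange_toComplₗ).induction_on
    (p := fun z : p.Compl × p.Compl => P z.1 z.2) (x, y) hP fun z => h z.1 z.2

lemma compl_mul_add (a b c : p.Compl) : a * (b + c) = a * b + a * c := by
  induction a using p.compl_induction with
  | hP =>
    refine isClosed_eq ?_ ?_
    · exact continuous_id.mul continuous_const
    · exact (continuous_id.mul continuous_const).add (continuous_id.mul continuous_const)
  | h a =>
  induction b, c using p.compl_induction₂ with
  | hP => refine isClosed_eq ?_ ?_ <;> fun_prop
  | h b c => simp only [← toComplₗ_mul, ← map_add, mul_add]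

lemma compl_add_mul (a b c : p.Compl) : (a + b) * c = a * c + b * c := by
  induction c using p.compl_induction with
  | hP =>
    refine isClosed_eq ?_ ?_
    · exact continuous_const.mul continuous_id
    · exact (continuous_const.mul continuous_id).add (continuous_const.mul continuous_id)
  | h c =>
  induction a, b using p.compl_induction₂ with
  | hP => refine isClosed_eq ?_ ?_ <;> fun_prop
  | h b c => simp only [← toComplₗ_mul, ← map_add, add_mul]

lemma compl_mul_assoc (a b c : p.Compl) : a * b * c = a * (b * c) := by
  induction a using p.compl_induction with
  | hP =>
    refine isClosed_eq ?_ ?_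
    · exact (continuous_id.mul continuous_const).mul continuous_const
    · exact continuous_id.mul continuous_const
  | h a =>
  induction b, c using p.compl_induction₂ with
  | hP => refine isClosed_eq ?_ ?_ <;> fun_prop
  | h b c => simp only [← toComplₗ_mul, mul_assoc]

lemma compl_zero_mul (a : p.Compl) : 0 * a = 0 := by
  have h := p.compl_add_mul 0 0 a
  rw [add_zero] at h
  exact left_eq_add.mp h

lemma compl_mul_zero (a : p.Compl) : a * 0 = 0 := by
  have h := p.compl_mul_add a 0 0
  rw [add_zero] at h
  exact left_eq_add.mp h

lemma compl_star_star (a : p.Compl) : star (star a) = a := by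
  induction a using p.compl_induction with
  | hP => refine isClosed_eq ?_ ?_ <;> fun_prop
  | h a => simp only [← toComplₗ_star, star_star]

lemma compl_star_mul (a b : p.Compl) : star (a * b) = star b * star a := by
  induction a, b using p.compl_induction₂ with
  | hP => refine isClosed_eq ?_ ?_ <;> fun_prop
  | h a b => simp only [← toComplₗ_star, ← toComplₗ_mul, star_mul]

lemma compl_star_add (a b : p.Compl) : star (a + b) = star a + star b := by
  induction a, b using p.compl_induction₂ with
  | hP => refine isClosed_eq ?_ ?_ <;> fun_prop
  | h a b => simp only [← toComplₗ_star, ← map_add, star_add]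

lemma compl_norm_mul_le (a b : p.Compl) : ‖a * b‖ ≤ ‖a‖ * ‖b‖ := by
  induction a, b using p.compl_induction₂ with
  | hP => refine isClosed_le ?_ ?_ <;> fun_prop
  | h a b =>
    simp only [← toComplₗ_mul, norm_toComplₗ]
    exact p.mul_le' a b

lemma compl_norm_mul_self_le (a : p.Compl) : ‖a‖ * ‖a‖ ≤ ‖star a * a‖ := by
  induction a using p.compl_induction with
  | hP => refine isClosed_le ?_ ?_ <;> fun_prop
  | h a =>
    rw [← toComplₗ_star, ← toComplₗ_mul, norm_toComplₗ, norm_toComplₗ, ← sq]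
    exact (p.star_mul_self_eq' a).ge

lemma compl_smul_mul [IsScalarTower ℂ R R] (c : ℂ) (a b : p.Compl) :
    (c • a) * b = c • (a * b) := by
  induction a, b using p.compl_induction₂ with
  | hP =>
    refine isClosed_eq ?_ ?_
    · exact (continuous_fst.const_smul c).mul continuous_snd
    · exact (continuous_fst.mul continuous_snd).const_smul c
  | h a b => simp only [← toComplₗ_mul, ← map_smul, smul_mul_assoc]

lemma compl_mul_smul [SMulCommClass ℂ R R] (c : ℂ) (a b : p.Compl) :
    a * (c • b) = c • (a * b) := by
  induction a, b using p.compl_induction₂ with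
  | hP =>
    refine isClosed_eq ?_ ?_
    · exact continuous_fst.mul (continuous_snd.const_smul c)
    · exact (continuous_fst.mul continuous_snd).const_smul c
  | h a b => simp only [← toComplₗ_mul, ← map_smul, mul_smul_comm]

lemma compl_star_smul [StarModule ℂ R] (c : ℂ) (a : p.Compl) :
    star (c • a) = star c • star a := by
  induction a using p.compl_induction with
  | hP =>
    refine isClosed_eq ?_ ?_
    · exact (continuous_id.const_smul c).star
    · exact continuous_star.const_smul (star c)
  | h a => simp only [← toComplₗ_star, ← map_smul, star_smul]

noncomputable instance : NonUnitalNormedRing p.Compl where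
  __ := (inferInstance : NormedAddCommGroup p.Compl)
  __ := (inferInstance : Mul p.Compl)
  zero_mul := p.compl_zero_mul
  mul_zero := p.compl_mul_zero
  left_distrib := p.compl_mul_add
  right_distrib := p.compl_add_mul
  mul_assoc := p.compl_mul_assoc
  norm_mul_le := p.compl_norm_mul_le

noncomputable instance [IsScalarTower ℂ R R] [SMulCommClass ℂ R R] [StarModule ℂ R] :
    NonUnitalCStarAlgebra p.Compl where
  __ := (inferInstance : NonUnitalNormedRing p.Compl)
  __ := (inferInstance : Star p.Compl)
  __ := (inferInstance : CompleteSpace p.Compl)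
  __ := (inferInstance : NormedSpace ℂ p.Compl)
  star_involutive := p.compl_star_star
  star_mul := p.compl_star_mul
  star_add := p.compl_star_add
  norm_mul_self_le := p.compl_norm_mul_self_le
  smul_assoc := p.compl_smul_mul
  smul_comm c a b := (p.compl_mul_smul c a b).symm
  star_smul := p.compl_star_smul

variable [IsScalarTower ℂ R R] [SMulCommClass ℂ R R] [StarModule ℂ R]

/-- The canonical ⋆-homomorphism from `R` to its completion. -/
noncomputable def toCompl : R →⋆ₙₐ[ℂ] p.Compl where
  toFun := p.toComplₗ
  map_smul' := map_smul p.toComplₗ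
  map_add' := map_add p.toComplₗ
  map_zero' := map_zero p.toComplₗ
  map_mul' := p.toComplₗ_mul
  map_star' := p.toComplₗ_star

lemma norm_toCompl (x : R) : ‖p.toCompl x‖ = p.toSeminorm x := p.norm_toComplₗ x

lemma denseRange_toCompl : DenseRange p.toCompl := p.denseRange_toComplₗ

/-- The continuous extension to the completion of a `p`-bounded linear map. -/
noncomputable def extendL {F : Type*} [NormedAddCommGroup F] [NormedSpace ℂ F] [CompleteSpace F]
    (f : R →ₗ[ℂ] F) (hf : ∀ x, ‖f x‖ ≤ p.toSeminorm x) : p.Compl →L[ℂ] F :=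
  (LinearMap.mkContinuous (E := p.Carrier) f 1
    (fun x => (hf x).trans_eq (one_mul _).symm)).extend
    (Completion.toComplL (𝕜 := ℂ) (E := p.Carrier))

lemma extendL_toCompl {F : Type*} [NormedAddCommGroup F] [NormedSpace ℂ F] [CompleteSpace F]
    (f : R →ₗ[ℂ] F) (hf : ∀ x, ‖f x‖ ≤ p.toSeminorm x) (x : R) :
    p.extendL f hf (p.toCompl x) = f x :=
  ContinuousLinearMap.extend_eq (e := Completion.toComplL (𝕜 := ℂ) (E := p.Carrier)) _
    (Completion.denseRange_coe (α := p.Carrier))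
    (Completion.isUniformInducing_coe p.Carrier) x

/-- The continuous extension to the completion of a `p`-bounded ⋆-homomorphism. -/
noncomputable def extend {B : Type*} [NonUnitalCStarAlgebra B]
    (f : R →⋆ₙₐ[ℂ] B) (hf : ∀ x, ‖f x‖ ≤ p.toSeminorm x) : p.Compl →⋆ₙₐ[ℂ] B :=
  let F : p.Compl →L[ℂ] B := p.extendL (LinearMapClass.linearMap f) hf
  have hF : ∀ x, F (p.toCompl x) = f x := p.extendL_toCompl (LinearMapClass.linearMap f) hf
  { toFun := F
    map_smul' := map_smul F
    map_zero' := map_zero F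
    map_add' := map_add F
    map_mul' := fun a b => by
      induction a, b using p.compl_induction₂ with
      | hP =>
        refine isClosed_eq ?_ ?_
        · exact F.continuous.comp continuous_mul
        · exact (F.continuous.comp continuous_fst).mul (F.continuous.comp continuous_snd)
      | h a b =>
        change F (p.toCompl a * p.toCompl b) = F (p.toCompl a) * F (p.toCompl b)
        rw [← map_mul, hF, hF, hF, map_mul]
    map_star' := fun a => by
      induction a using p.compl_induction with
      | hP =>
        refine isClosed_eq ?_ ?_
        · exact F.continuous.comp continuous_star
        · exact F.continuous.star
      | h a =>
        change F (star (p.toCompl a)) = star (F (p.toCompl a))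
        rw [← map_star, hF, hF, map_star] }

lemma extend_toCompl {B : Type*} [NonUnitalCStarAlgebra B]
    (f : R →⋆ₙₐ[ℂ] B) (hf : ∀ x, ‖f x‖ ≤ p.toSeminorm x) (x : R) :
    p.extend f hf (p.toCompl x) = f x :=
  p.extendL_toCompl (LinearMapClass.linearMap f) hf x

/-- The C⋆-seminorm obtained by composing with a ⋆-homomorphism. -/
noncomputable def comp {S : Type*} [NonUnitalRing S] [StarRing S] [Module ℂ S] (q : CStarSeminorm S)
    (f : R →⋆ₙₐ[ℂ] S) : CStarSeminorm R where
  toSeminorm := q.toSeminorm.comp (LinearMapClass.linearMap f)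
  mul_le' x y := by
    change q.toSeminorm (f (x * y)) ≤ q.toSeminorm (f x) * q.toSeminorm (f y)
    rw [map_mul]; exact q.mul_le' _ _
  star_eq' x := by
    change q.toSeminorm (f (star x)) = q.toSeminorm (f x)
    rw [map_star]; exact q.star_eq' _
  star_mul_self_eq' x := by
    change q.toSeminorm (f (star x * x)) = q.toSeminorm (f x) ^ 2
    rw [map_mul, map_star]; exact q.star_mul_self_eq' _

end Completion

/-- Every C⋆-seminorm on a C⋆-algebra is dominated by the norm. -/
lemma le_norm {A : Type*} [NonUnitalCStarAlgebra A] (p : CStarSeminorm A) (a : A) :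
    p.toSeminorm a ≤ ‖a‖ := by
  rw [← p.norm_toCompl]
  exact NonUnitalStarAlgHom.norm_apply_le p.toCompl a

end CStarSeminorm

/-- A partial action of a discrete group `G` on a C⋆-algebra `A`: closed two-sided ideals `A_g`
(`dom g`) and ⋆-isomorphisms `α_g : A_{g⁻¹} → A_g` (`map g`) such that `A_e = A`, `α_e = id`, and
`α_{gh}` extends `α_g ∘ α_h`, the latter having the domain `{x ∈ A_{h⁻¹} | α_h x ∈ A_{g⁻¹}}`.
The ideals are given as ⋆-subalgebras, as closed two-sided ideals of C⋆-algebras are always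
self-adjoint subspaces. -/
structure PartialAction (G : Type*) [Group G] (A : Type*) [NonUnitalCStarAlgebra A] where
  dom : G → NonUnitalStarSubalgebra ℂ A
  isClosed_dom : ∀ g, IsClosed (dom g : Set A)
  mul_mem_left : ∀ (g : G) (a : A) {x : A}, x ∈ dom g → a * x ∈ dom g
  mul_mem_right : ∀ (g : G) {x : A} (a : A), x ∈ dom g → x * a ∈ dom g
  map : ∀ g, dom g⁻¹ ≃⋆ₐ[ℂ] dom g
  dom_one : dom 1 = ⊤
  map_one : ∀ x : dom (1 : G)⁻¹, (map 1 x : A) = x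
  map_map : ∀ (g h : G) (x : dom h⁻¹) (hx : (map h x : A) ∈ dom g⁻¹),
    ∃ hx' : (x : A) ∈ dom (g * h)⁻¹, (map (g * h) ⟨x, hx'⟩ : A) = map g ⟨map h x, hx⟩

namespace PartialAction

open scoped Classical

variable {G : Type*} [Group G] {A : Type*} [NonUnitalCStarAlgebra A] (α : PartialAction G A)

/-- The map `α_g`, applied to elements of `A`; outside of its domain `A_{g⁻¹}` it is given the
value `0`, but it is only used there for elements of `A_{g⁻¹}`. -/
noncomputable def act (g : G) (x : A) : A :=
  if hx : x ∈ α.dom g⁻¹ then (α.map g ⟨x, hx⟩ : A) else 0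

lemma act_of_mem {g : G} {x : A} (hx : x ∈ α.dom g⁻¹) : α.act g x = α.map g ⟨x, hx⟩ :=
  dif_pos hx

lemma act_mem (g : G) (x : A) : α.act g x ∈ α.dom g := by
  unfold act
  split_ifs
  · exact SetLike.coe_mem _
  · exact zero_mem _

lemma act_inv_mem (g : G) (x : A) : α.act g⁻¹ x ∈ α.dom g⁻¹ := α.act_mem g⁻¹ x

lemma mem_inv_inv {g : G} {x : A} (hx : x ∈ α.dom g) : x ∈ α.dom g⁻¹⁻¹ := by rwa [inv_inv]

lemma mem_dom_one (x : A) : x ∈ α.dom 1 := by rw [α.dom_one]; trivial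

lemma act_add {g : G} {x y : A} (hx : x ∈ α.dom g⁻¹) (hy : y ∈ α.dom g⁻¹) :
    α.act g (x + y) = α.act g x + α.act g y := by
  rw [α.act_of_mem hx, α.act_of_mem hy, α.act_of_mem (add_mem hx hy)]
  exact congrArg Subtype.val (map_add (α.map g) ⟨x, hx⟩ ⟨y, hy⟩)

lemma act_smul {g : G} (c : ℂ) {x : A} (hx : x ∈ α.dom g⁻¹) :
    α.act g (c • x) = c • α.act g x := by
  rw [α.act_of_mem hx, α.act_of_mem (SMulMemClass.smul_mem c hx)]
  exact congrArg Subtype.val (map_smul (α.map g) c ⟨x, hx⟩)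

lemma act_mul {g : G} {x y : A} (hx : x ∈ α.dom g⁻¹) (hy : y ∈ α.dom g⁻¹) :
    α.act g (x * y) = α.act g x * α.act g y := by
  rw [α.act_of_mem hx, α.act_of_mem hy, α.act_of_mem (mul_mem hx hy)]
  exact congrArg Subtype.val (map_mul (α.map g) ⟨x, hx⟩ ⟨y, hy⟩)

lemma act_star {g : G} {x : A} (hx : x ∈ α.dom g⁻¹) :
    α.act g (star x) = star (α.act g x) := by
  rw [α.act_of_mem hx, α.act_of_mem (star_mem hx)]
  exact congrArg Subtype.val (map_star (α.map g) ⟨x, hx⟩)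

lemma act_act {g h : G} {x : A} (hx : x ∈ α.dom h⁻¹) (hx' : α.act h x ∈ α.dom g⁻¹) :
    x ∈ α.dom (g * h)⁻¹ ∧ α.act (g * h) x = α.act g (α.act h x) := by
  have h1 := α.act_of_mem hx
  rw [h1] at hx'
  obtain ⟨h2, h3⟩ := α.map_map g h ⟨x, hx⟩ hx'
  refine ⟨h2, ?_⟩
  rw [α.act_of_mem h2, h3, h1, α.act_of_mem hx']

lemma act_one (x : A) : α.act 1 x = x := by
  rw [α.act_of_mem (x := x) (by rw [inv_one]; exact α.mem_dom_one x), α.map_one]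

lemma act_inv_act {g : G} {x : A} (hx : x ∈ α.dom g⁻¹) : α.act g⁻¹ (α.act g x) = x := by
  rw [← (α.act_act (g := g⁻¹) hx (α.mem_inv_inv (α.act_mem g x))).2, inv_mul_cancel, act_one]

lemma act_act_inv {g : G} {x : A} (hx : x ∈ α.dom g) : α.act g (α.act g⁻¹ x) = x := by
  rw [← (α.act_act (g := g) (h := g⁻¹) (α.mem_inv_inv hx) (α.act_mem g⁻¹ x)).2,
    mul_inv_cancel, act_one]

lemma act_mem_mul {g h : G} {x : A} (hx : x ∈ α.dom g⁻¹) (hx' : x ∈ α.dom h) :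
    α.act g x ∈ α.dom (g * h) := by
  have h1 := α.act_act_inv hx'
  have h2 := (α.act_act (g := g) (h := h) (x := α.act h⁻¹ x) (α.act_mem _ _)
    (by rwa [h1])).2
  rw [h1] at h2
  rw [← h2]
  exact α.act_mem _ _

lemma act_mul_act {g : G} (a c : A) {b : A} (hb : b ∈ α.dom g) :
    α.act g (α.act g⁻¹ (a * b) * c) = a * α.act g (α.act g⁻¹ b * c) := by
  set d := α.act g (α.act g⁻¹ (a * b) * c) - a * α.act g (α.act g⁻¹ b * c) with hd
  have hmem : d ∈ α.dom g :=
    sub_mem (α.act_mem _ _) (α.mul_mem_left _ _ (α.act_mem _ _))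
  have key : ∀ e ∈ α.dom g, e * d = 0 := by
    intro e he
    have hab := α.mul_mem_left g a hb
    have hea := α.mul_mem_right g a he
    have hi : ∀ {x}, x ∈ α.dom g → x ∈ α.dom g⁻¹⁻¹ := α.mem_inv_inv
    have comm : ∀ {x y : A}, x ∈ α.dom g → y ∈ α.dom g →
        α.act g (α.act g⁻¹ (x * y) * c) = x * α.act g (α.act g⁻¹ y * c) := by
      intro x y hx hy
      rw [α.act_mul (hi hx) (hi hy), mul_assoc,
        α.act_mul (α.act_mem _ _) (α.mul_mem_right _ _ (α.act_mem _ _)), α.act_act_inv hx]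
    rw [hd, mul_sub, ← comm he hab, ← mul_assoc, ← mul_assoc, comm hea hb, sub_self]
  have h0 : star d * d = 0 := key _ (star_mem hmem)
  exact sub_eq_zero.mp (CStarRing.star_mul_self_eq_zero_iff d |>.mp h0)

/-- The finite formal sums `∑ a_g δ_g` with `a_g ∈ A_g`. -/
def AlgCrossedProduct : Type _ := Π₀ g, α.dom g

namespace AlgCrossedProduct

noncomputable instance : AddCommGroup α.AlgCrossedProduct :=
  inferInstanceAs (AddCommGroup (Π₀ g, α.dom g))

noncomputable instance : Module ℂ α.AlgCrossedProduct :=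
  inferInstanceAs (Module ℂ (Π₀ g, α.dom g))

/-- The element `a δ_g`, as a linear function of `a ∈ A_g`. -/
noncomputable def δ (g : G) : α.dom g →ₗ[ℂ] α.AlgCrossedProduct :=
  DFinsupp.lsingle (R := ℂ) (M := fun g => α.dom g) g

/-- The coefficient `a_g ∈ A_g` of `∑ a_g δ_g`. -/
noncomputable def coeff (g : G) : α.AlgCrossedProduct →ₗ[ℂ] α.dom g :=
  DFinsupp.lapply (R := ℂ) (M := fun g => α.dom g) g

/-- The linear map out of the formal sums with prescribed values on the `a δ_g`. -/
noncomputable def lift {N : Type*} [AddCommGroup N] [Module ℂ N] (f : ∀ g, α.dom g →ₗ[ℂ] N) :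
    α.AlgCrossedProduct →ₗ[ℂ] N :=
  DFinsupp.lsum ℂ (M := fun g => α.dom g) f

variable {α}

lemma lift_δ {N : Type*} [AddCommGroup N] [Module ℂ N] (f : ∀ g, α.dom g →ₗ[ℂ] N)
    (g : G) (a : α.dom g) : lift α f (δ α g a) = f g a :=
  DFinsupp.lsum_single (R := ℂ) ℂ f g a

lemma induction {P : α.AlgCrossedProduct → Prop} (h0 : P 0)
    (hadd : ∀ x y, P x → P y → P (x + y)) (hδ : ∀ g a, P (δ α g a)) (x) : P x :=
  DFinsupp.induction x h0 fun g a _ _ _ hy => hadd _ _ (hδ g a) hy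

lemma δ_congr {g h : G} {a : α.dom g} {b : α.dom h} (hgh : g = h) (hab : (a : A) = b) :
    δ α g a = δ α h b := by
  subst hgh
  exact congrArg _ (Subtype.ext hab)

lemma δ_eq_zero {g : G} {a : α.dom g} (h : (a : A) = 0) : δ α g a = 0 := by
  rw [show a = 0 from Subtype.ext h, map_zero]

lemma coeff_δ_same (g : G) (a : α.dom g) : coeff α g (δ α g a) = a :=
  DFinsupp.single_eq_same (β := fun g => α.dom g)

lemma coeff_δ_ne {g h : G} (hgh : g ≠ h) (a : α.dom g) : coeff α h (δ α g a) = 0 :=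
  DFinsupp.single_eq_of_ne hgh.symm

variable (α)

/-- The product `a δ_g * b δ_h = α_g(α_{g⁻¹}(a) b) δ_{gh}` on the fibres. -/
noncomputable def fiberMul (g h : G) : α.dom g →ₗ[ℂ] α.dom h →ₗ[ℂ] α.dom (g * h) :=
  LinearMap.mk₂ ℂ
    (fun a b => ⟨α.act g (α.act g⁻¹ a * b),
      α.act_mem_mul (α.mul_mem_right _ _ (α.act_mem _ _)) (α.mul_mem_left _ _ b.2)⟩)
    (fun a a' b => Subtype.ext <| by
      simp only [AddMemClass.coe_add]
      rw [α.act_add (α.mem_inv_inv a.2) (α.mem_inv_inv a'.2), add_mul,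
        α.act_add (α.mul_mem_right _ _ (α.act_mem _ _)) (α.mul_mem_right _ _ (α.act_mem _ _))])
    (fun c a b => Subtype.ext <| by
      simp only [SetLike.val_smul]
      rw [α.act_smul c (α.mem_inv_inv a.2), smul_mul_assoc,
        α.act_smul c (α.mul_mem_right _ _ (α.act_mem _ _))])
    (fun a b b' => Subtype.ext <| by
      simp only [AddMemClass.coe_add]
      rw [mul_add,
        α.act_add (α.mul_mem_right _ _ (α.act_mem _ _)) (α.mul_mem_right _ _ (α.act_mem _ _))])
    (fun c a b => Subtype.ext <| by
      simp only [SetLike.val_smul]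
      rw [mul_smul_comm, α.act_smul c (α.mul_mem_right _ _ (α.act_mem _ _))])

lemma coe_fiberMul {g h : G} (a : α.dom g) (b : α.dom h) :
    (fiberMul α g h a b : A) = α.act g (α.act g⁻¹ a * b) := rfl

/-- The involution `(a δ_g)* = α_{g⁻¹}(a*) δ_{g⁻¹}` on the fibres. -/
noncomputable def fiberStar (g : G) : α.dom g →+ α.dom g⁻¹ where
  toFun a := ⟨α.act g⁻¹ (star (a : A)), α.act_mem _ _⟩
  map_zero' := Subtype.ext <| by
    have h := α.act_smul (g := g⁻¹) 0 (zero_mem _)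
    simpa using h
  map_add' a b := Subtype.ext <| by
    simp only [AddMemClass.coe_add, star_add]
    rw [α.act_add (α.mem_inv_inv (star_mem a.2)) (α.mem_inv_inv (star_mem b.2))]

lemma coe_fiberStar {g : G} (a : α.dom g) :
    (fiberStar α g a : A) = α.act g⁻¹ (star (a : A)) := rfl

/-- The multiplication of formal sums, as a bilinear map. -/
noncomputable def mulₗ : α.AlgCrossedProduct →ₗ[ℂ] α.AlgCrossedProduct →ₗ[ℂ]
    α.AlgCrossedProduct :=
  lift α fun g => (DFinsupp.lsum ℂ (M := fun g => α.dom g)).toLinearMap ∘ₗ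
    LinearMap.pi fun h => (fiberMul α g h).compr₂ (δ α (g * h))

noncomputable instance : Mul α.AlgCrossedProduct where
  mul x y := mulₗ α x y

noncomputable instance : Star α.AlgCrossedProduct where
  star := DFinsupp.sumAddHom (β := fun g => α.dom g) fun g =>
    (δ α g⁻¹).toAddMonoidHom.comp (fiberStar α g)

variable {α}

lemma mul_def (x y : α.AlgCrossedProduct) : x * y = mulₗ α x y := rfl

lemma δ_mul_δ (g h : G) (a : α.dom g) (b : α.dom h) :
    δ α g a * δ α h b = δ α (g * h) (fiberMul α g h a b) := by
  rw [mul_def, mulₗ, lift_δ]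
  exact lift_δ (fun h => ((fiberMul α g h).compr₂ (δ α (g * h))) a) h b

lemma star_δ (g : G) (a : α.dom g) : star (δ α g a) = δ α g⁻¹ (fiberStar α g a) :=
  DFinsupp.sumAddHom_single (β := fun g => α.dom g) _ g a

noncomputable instance : NonUnitalNonAssocRing α.AlgCrossedProduct where
  left_distrib x y z := map_add (mulₗ α x) y z
  right_distrib x y z := LinearMap.map_add₂ (mulₗ α) x y z
  zero_mul x := LinearMap.map_zero₂ (mulₗ α) x
  mul_zero x := map_zero (mulₗ α x)

lemma star_add' (x y : α.AlgCrossedProduct) : star (x + y) = star x + star y :=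
  map_add (DFinsupp.sumAddHom (β := fun g => α.dom g) fun g =>
    (δ α g⁻¹).toAddMonoidHom.comp (fiberStar α g)) x y

lemma star_zero' : star (0 : α.AlgCrossedProduct) = 0 :=
  map_zero (DFinsupp.sumAddHom (β := fun g => α.dom g) fun g =>
    (δ α g⁻¹).toAddMonoidHom.comp (fiberStar α g))

lemma δ_mul_assoc (g h k : G) (a : α.dom g) (b : α.dom h) (c : α.dom k) :
    δ α g a * δ α h b * δ α k c = δ α g a * (δ α h b * δ α k c) := by
  simp only [δ_mul_δ]
  refine δ_congr (mul_assoc g h k) ?_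
  simp only [coe_fiberMul]
  set a' := α.act g⁻¹ (a : A)
  have ha' : a' ∈ α.dom g⁻¹ := α.act_mem _ _
  rw [← α.act_mul_act a' c b.2]
  have h1 : a' * (b : A) ∈ α.dom g⁻¹ := α.mul_mem_right _ _ ha'
  have h2 : a' * (b : A) ∈ α.dom h := α.mul_mem_left _ _ b.2
  have h3 : α.act h (α.act h⁻¹ (a' * b)) = a' * b := α.act_act_inv h2
  have h4 : α.act h⁻¹ (a' * b) ∈ α.dom h⁻¹ := α.act_mem _ _
  have h5 := α.act_act (g := g) h4 (by rwa [h3])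
  rw [h3] at h5
  have h6 : α.act (g * h)⁻¹ (α.act g (a' * b)) = α.act h⁻¹ (a' * b) := by
    rw [← h5.2, α.act_inv_act h5.1]
  rw [h6]
  refine (α.act_act (g := g) (h := h) (α.mul_mem_right _ _ h4) ?_).2
  rw [α.act_mul_act a' c b.2]
  exact α.mul_mem_right _ _ ha'

lemma δ_star_mul (g h : G) (a : α.dom g) (b : α.dom h) :
    star (δ α g a * δ α h b) = star (δ α h b) * star (δ α g a) := by
  simp only [δ_mul_δ, star_δ]
  refine δ_congr (mul_inv_rev g h) ?_
  simp only [coe_fiberMul, coe_fiberStar]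
  have ha' : α.act g⁻¹ (a : A) ∈ α.dom g⁻¹ := α.act_mem _ _
  have hb : star (b : A) ∈ α.dom h := star_mem b.2
  rw [inv_inv, α.act_act_inv hb, ← α.act_star (α.mul_mem_right _ _ ha'), star_mul,
    α.act_star (α.mem_inv_inv a.2)]
  set c := star (b : A) * star (α.act g⁻¹ (a : A)) with hc
  have hc1 : c ∈ α.dom g⁻¹ := α.mul_mem_left _ _ (star_mem ha')
  have hc2 : c ∈ α.dom h := α.mul_mem_right _ _ hb
  have h3 : α.act h (α.act h⁻¹ c) = c := α.act_act_inv hc2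
  have h5 := α.act_act (g := g) (α.act_mem h⁻¹ c) (by rwa [h3])
  rw [h3] at h5
  rw [← h5.2, α.act_inv_act h5.1]

lemma δ_star_star (g : G) (a : α.dom g) : star (star (δ α g a)) = δ α g a := by
  simp only [star_δ]
  refine δ_congr (inv_inv g) ?_
  simp only [coe_fiberStar]
  rw [inv_inv, α.act_star (α.act_mem _ _), α.act_act_inv (star_mem a.2), star_star]

lemma δ_star_smul (c : ℂ) (g : G) (a : α.dom g) :
    star (c • δ α g a) = star c • star (δ α g a) := by
  rw [← map_smul, star_δ, star_δ, ← map_smul]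
  refine δ_congr rfl ?_
  simp only [coe_fiberStar, SetLike.val_smul, star_smul]
  rw [α.act_smul _ (α.mem_inv_inv (star_mem a.2))]

/-- The ⋆-algebra structure of the algebraic crossed product. -/
noncomputable instance : NonUnitalRing α.AlgCrossedProduct where
  mul_assoc x y z := by
    induction x using induction with
    | h0 => simp only [zero_mul]
    | hadd x x' hx hx' => simp only [add_mul, hx, hx']
    | hδ g a =>
      induction y using induction with
      | h0 => simp only [zero_mul, mul_zero]
      | hadd y y' hy hy' => simp only [mul_add, add_mul, hy, hy']
      | hδ h b =>
        induction z using induction with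
        | h0 => simp only [mul_zero]
        | hadd z z' hz hz' => simp only [mul_add, hz, hz']
        | hδ k c => exact δ_mul_assoc g h k a b c

noncomputable instance : StarRing α.AlgCrossedProduct where
  star_add := star_add'
  star_involutive x := by
    induction x using induction with
    | h0 => rw [star_zero', star_zero']
    | hadd x x' hx hx' => rw [star_add', star_add', hx, hx']
    | hδ g a => exact δ_star_star g a
  star_mul x y := by
    induction x using induction with
    | h0 => rw [zero_mul, star_zero', mul_zero]
    | hadd x x' hx hx' => rw [add_mul, star_add', hx, hx', star_add', mul_add]
    | hδ g a =>
      induction y using induction with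
      | h0 => rw [mul_zero, star_zero', zero_mul]
      | hadd y y' hy hy' => rw [mul_add, star_add', hy, hy', star_add', add_mul]
      | hδ h b => exact δ_star_mul g h a b

instance : StarModule ℂ α.AlgCrossedProduct where
  star_smul c x := by
    induction x using induction with
    | h0 => rw [smul_zero, star_zero', smul_zero]
    | hadd x x' hx hx' => rw [smul_add, star_add', hx, hx', star_add', smul_add]
    | hδ g a => exact δ_star_smul c g a

instance : IsScalarTower ℂ α.AlgCrossedProduct α.AlgCrossedProduct where
  smul_assoc c x y := LinearMap.map_smul₂ (mulₗ α) c x y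

instance : SMulCommClass ℂ α.AlgCrossedProduct α.AlgCrossedProduct where
  smul_comm c x y := (map_smul (mulₗ α x) c y).symm

end AlgCrossedProduct

end PartialAction

namespace PartialAction

open scoped Classical

namespace AlgCrossedProduct

variable {G : Type*} [Group G] {A : Type*} [NonUnitalCStarAlgebra A] {α : PartialAction G A}

variable (α)

/-- The embedding `a ↦ a δ_e` of `A` into the algebraic crossed product. -/
noncomputable def ι : A →⋆ₙₐ[ℂ] α.AlgCrossedProduct where
  toFun a := δ α 1 ⟨a, α.mem_dom_one a⟩
  map_smul' c a := map_smul (δ α 1) c ⟨a, α.mem_dom_one a⟩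
  map_zero' := δ_eq_zero rfl
  map_add' a b := map_add (δ α 1) ⟨a, α.mem_dom_one a⟩ ⟨b, α.mem_dom_one b⟩
  map_mul' a b := by
    rw [δ_mul_δ]
    refine δ_congr (mul_one 1).symm ?_
    simp only [coe_fiberMul, inv_one, act_one]
  map_star' a := by
    rw [star_δ]
    refine δ_congr inv_one.symm ?_
    simp only [coe_fiberStar, inv_one, act_one]

/-- The map `∑ a_g δ_g ↦ a_e`. -/
noncomputable def coeffOne : α.AlgCrossedProduct →ₗ[ℂ] A where
  toFun x := coeff α 1 x
  map_add' x y := by rw [map_add]; rfl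
  map_smul' c x := by rw [map_smul]; rfl

variable {α}

lemma ι_apply (a : A) : ι α a = δ α 1 ⟨a, α.mem_dom_one a⟩ := rfl

lemma δ_eq_ι {g : G} (hg : g = 1) (a : α.dom g) : δ α g a = ι α (a : A) :=
  δ_congr hg rfl

lemma coeffOne_δ (g : G) (a : α.dom g) : coeffOne α (δ α g a) = if g = 1 then (a : A) else 0 := by
  split_ifs with h
  · subst h
    exact congrArg Subtype.val (coeff_δ_same 1 a)
  · exact congrArg Subtype.val (coeff_δ_ne h a)

/-- The C⋆-seminorms of a fixed formal sum are bounded. -/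
lemma exists_bound (x : α.AlgCrossedProduct) :
    ∃ C : ℝ, ∀ p : CStarSeminorm α.AlgCrossedProduct, p.toSeminorm x ≤ C := by
  induction x using induction with
  | h0 => exact ⟨0, fun p => (map_zero p.toSeminorm).le⟩
  | hadd x y hx hy =>
    obtain ⟨C, hC⟩ := hx
    obtain ⟨D, hD⟩ := hy
    exact ⟨C + D, fun p => (map_add_le_add p.toSeminorm x y).trans (add_le_add (hC p) (hD p))⟩
  | hδ g a =>
    refine ⟨‖(fiberMul α g⁻¹ g (fiberStar α g a) a : A)‖ + 1, fun p => ?_⟩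
    have h1 : p.toSeminorm (star (δ α g a) * δ α g a) = p.toSeminorm (δ α g a) ^ 2 :=
      p.star_mul_self_eq' (δ α g a)
    rw [star_δ, δ_mul_δ, δ_eq_ι (inv_mul_cancel g)] at h1
    have h2 : p.toSeminorm (ι α (fiberMul α g⁻¹ g (fiberStar α g a) a : A)) ≤
        ‖(fiberMul α g⁻¹ g (fiberStar α g a) a : A)‖ := (p.comp (ι α)).le_norm _
    rw [h1] at h2
    nlinarith [sq_nonneg (p.toSeminorm (δ α g a) - 1)]

lemma bddAbove (x : α.AlgCrossedProduct) :
    BddAbove (Set.range fun p : CStarSeminorm α.AlgCrossedProduct => p.toSeminorm x) := by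
  obtain ⟨C, hC⟩ := exists_bound x
  exact ⟨C, by rintro _ ⟨p, rfl⟩; exact hC p⟩

instance : Nonempty (CStarSeminorm α.AlgCrossedProduct) :=
  ⟨{ toSeminorm := 0
     mul_le' := fun _ _ => (mul_zero (0 : ℝ)).ge
     star_eq' := fun _ => rfl
     star_mul_self_eq' := fun _ => (zero_pow two_ne_zero).symm }⟩

lemma le_iSup_seminorm (p : CStarSeminorm α.AlgCrossedProduct) (x : α.AlgCrossedProduct) :
    p.toSeminorm x ≤ ⨆ q : CStarSeminorm α.AlgCrossedProduct, q.toSeminorm x :=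
  le_ciSup (bddAbove x) p

variable (α)

/-- The maximal norm: the supremum of all C⋆-seminorms on the algebraic crossed product. -/
noncomputable def maxSeminorm : CStarSeminorm α.AlgCrossedProduct where
  toSeminorm := Seminorm.of
    (fun x => ⨆ p : CStarSeminorm α.AlgCrossedProduct, p.toSeminorm x)
    (fun x y => ciSup_le fun p => (map_add_le_add p.toSeminorm x y).trans
      (add_le_add (le_iSup_seminorm p x) (le_iSup_seminorm p y)))
    (fun c x => by
      simp only [map_smul_eq_mul]
      exact (Real.mul_iSup_of_nonneg (norm_nonneg c) _).symm)
  mul_le' x y := ciSup_le fun p => (p.mul_le' x y).trans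
    (mul_le_mul (le_iSup_seminorm p x) (le_iSup_seminorm p y) (apply_nonneg p.toSeminorm y)
      ((apply_nonneg p.toSeminorm x).trans (le_iSup_seminorm p x)))
  star_eq' x := iSup_congr fun p => p.star_eq' x
  star_mul_self_eq' x := by
    refine le_antisymm (ciSup_le fun p => ?_) ?_
    · exact (p.star_mul_self_eq' x).le.trans
        (pow_le_pow_left₀ (apply_nonneg p.toSeminorm x) (le_iSup_seminorm p x) 2)
    · have h0 : 0 ≤ ⨆ p : CStarSeminorm α.AlgCrossedProduct, p.toSeminorm (star x * x) :=
        Real.iSup_nonneg fun p => apply_nonneg p.toSeminorm _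
      refine (pow_le_pow_left₀ (Real.iSup_nonneg fun p : CStarSeminorm α.AlgCrossedProduct => apply_nonneg p.toSeminorm x)
        (ciSup_le fun p => Real.le_sqrt_of_sq_le ?_) 2).trans_eq (Real.sq_sqrt h0)
      exact (p.star_mul_self_eq' x).ge.trans (le_iSup_seminorm p (star x * x))

variable {α}

lemma maxSeminorm_apply (x : α.AlgCrossedProduct) : (maxSeminorm α).toSeminorm x =
    ⨆ p : CStarSeminorm α.AlgCrossedProduct, p.toSeminorm x := rfl

lemma le_maxSeminorm (p : CStarSeminorm α.AlgCrossedProduct) (x : α.AlgCrossedProduct) :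
    p.toSeminorm x ≤ (maxSeminorm α).toSeminorm x :=
  le_iSup_seminorm p x

lemma coeffOne_star (x : α.AlgCrossedProduct) : coeffOne α (star x) = star (coeffOne α x) := by
  induction x using induction with
  | h0 => simp only [star_zero, map_zero]
  | hadd x y hx hy => simp only [star_add, map_add, hx, hy]
  | hδ g a =>
    rw [star_δ, coeffOne_δ, coeffOne_δ]
    by_cases h : g = 1
    · subst h
      simp only [inv_one, if_true, coe_fiberStar, act_one]
    · simp only [inv_eq_one, h, if_false, star_zero]

lemma coeffOne_ι (a : A) : coeffOne α (ι α a) = a := by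
  rw [ι_apply, coeffOne_δ, if_pos rfl]

lemma coeffOne_ι_mul (a : A) (x : α.AlgCrossedProduct) :
    coeffOne α (ι α a * x) = a * coeffOne α x := by
  induction x using induction with
  | h0 => simp only [mul_zero, map_zero]
  | hadd x y hx hy => simp only [mul_add, map_add, hx, hy]
  | hδ g b =>
    rw [ι_apply, δ_mul_δ, coeffOne_δ, coeffOne_δ]
    by_cases hg : g = 1
    · simp only [hg, mul_one, if_true, coe_fiberMul, inv_one, act_one]
    · simp only [hg, one_mul, if_false, mul_zero]

lemma coeffOne_mul_ι (a : A) (x : α.AlgCrossedProduct) :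
    coeffOne α (x * ι α a) = coeffOne α x * a := by
  have h := coeffOne_ι_mul (star a) (star x)
  rw [map_star, ← star_mul, coeffOne_star, coeffOne_star, ← star_mul] at h
  exact star_injective h

lemma δ_mul_star_δ (g : G) (a b : α.dom g) :
    δ α g a * star (δ α g b) = ι α ((a : A) * star (b : A)) := by
  rw [star_δ, δ_mul_δ, ι_apply]
  refine δ_congr (mul_inv_cancel g) ?_
  simp only [coe_fiberMul, coe_fiberStar]
  rw [← α.act_mul (α.mem_inv_inv a.2) (α.mem_inv_inv (star_mem b.2)),
    α.act_act_inv (mul_mem a.2 (star_mem b.2))]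

lemma coeffOne_mul_star (x : α.AlgCrossedProduct) : ∃ s : Finset G,
    coeffOne α (x * star x) = ∑ g ∈ s, (coeff α g x : A) * star (coeff α g x : A) ∧
      ∀ g, g ∉ s → coeff α g x = 0 := by
  let s := DFinsupp.support (β := fun g => α.dom g) x
  refine ⟨s, ?_, fun g hg => DFinsupp.notMem_support_iff.mp hg⟩
  have hx : x = ∑ g ∈ s, δ α g (coeff α g x) :=
    (DFinsupp.sum_single (β := fun g => α.dom g) (f := x)).symm
  have h1 : x * star x = ∑ g ∈ s, ∑ h ∈ s, δ α g (coeff α g x) * star (δ α h (coeff α h x)) := by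
    conv_lhs => rw [hx]
    rw [star_sum, Finset.sum_mul_sum]
  rw [h1, map_sum]
  refine Finset.sum_congr rfl fun g hg => ?_
  rw [map_sum, Finset.sum_eq_single_of_mem g hg]
  · rw [δ_mul_star_δ, coeffOne_ι]
  · intro h _ hgh
    rw [star_δ, δ_mul_δ, coeffOne_δ, if_neg]
    intro h'
    exact hgh (mul_inv_eq_one.mp h').symm

lemma exists_completion_square (a : A) : ∃ (c : ℂ) (b : A), c * star c = (‖a‖ ^ 2 : ℝ) ∧
    c • star b + star c • b + b * star b = -(a * star a) := by
  let _ := CStarAlgebra.spectralOrder (Unitization ℂ A)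
  have _ := CStarAlgebra.spectralOrderedRing (Unitization ℂ A)
  have h := CStarAlgebra.mul_star_le_algebraMap_norm_sq (a := (a : Unitization ℂ A))
  rw [← sub_nonneg, CStarAlgebra.nonneg_iff_eq_mul_star_self] at h
  obtain ⟨k, hk⟩ := h
  refine ⟨k.fst, k.snd, ?_, ?_⟩
  · have := congrArg (fun z => z.fst) hk
    simpa [Unitization.norm_inr, Algebra.algebraMap_eq_smul_one, sub_eq_add_neg] using this.symm
  · have := congrArg (fun z => z.snd) hk
    simpa [Unitization.norm_inr, Algebra.algebraMap_eq_smul_one, sub_eq_add_neg, add_assoc] using this.symm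

section RegularModule

/-- There is a C⋆-seminorm on the algebraic crossed product that dominates `∑ a_g δ_g ↦ ‖a_e‖`. -/
lemma exists_seminorm_coeffOne_le : ∃ p : CStarSeminorm α.AlgCrossedProduct,
    ∀ x, ‖coeffOne α x‖ ≤ p.toSeminorm x := by
  let _ := CStarAlgebra.spectralOrder A
  have _ := CStarAlgebra.spectralOrderedRing A
  have nonneg : ∀ x : α.AlgCrossedProduct, 0 ≤ coeffOne α (x * star x) := fun x => by
    obtain ⟨s, hs, -⟩ := coeffOne_mul_star x
    rw [hs]
    exact Finset.sum_nonneg fun g _ => mul_star_self_nonneg _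
  let _ : SMul A α.AlgCrossedProduct := ⟨fun a y => ι α a * y⟩
  let _ : Norm α.AlgCrossedProduct := ⟨fun x => √‖coeffOne α (x * star x)‖⟩
  let _ : CStarModule A α.AlgCrossedProduct :=
    { inner := fun x y => coeffOne α (y * star x)
      inner_add_right := fun {x y z} => by rw [add_mul, map_add]
      inner_self_nonneg := fun {x} => nonneg x
      inner_self := fun {x} => by
        refine ⟨fun h => ?_, fun h => by rw [h, zero_mul, map_zero]⟩
        obtain ⟨s, hs, hs'⟩ := coeffOne_mul_star x
        rw [hs, Finset.sum_eq_zero_iff_of_nonneg fun g _ => mul_star_self_nonneg _] at h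
        refine DFinsupp.ext fun g => ?_
        by_cases hg : g ∈ s
        · exact Subtype.ext (CStarRing.mul_star_self_eq_zero_iff _ |>.mp (h g hg))
        · exact hs' g hg
      inner_op_smul_right := fun {a x y} => by
        change coeffOne α (ι α a * y * star x) = _
        rw [mul_assoc, coeffOne_ι_mul]
      inner_smul_right_complex := fun {z x y} => by rw [smul_mul_assoc, map_smul]
      star_inner := fun x y => by rw [← coeffOne_star, star_mul, star_star]
      norm_eq_sqrt_norm_inner_self := fun x => rfl }
  let _ : NormedAddCommGroup α.AlgCrossedProduct := CStarModule.normedAddCommGroup A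
  let _ : NormedSpace ℂ α.AlgCrossedProduct := NormedSpace.ofCore (CStarModule.normedSpaceCore A)
  have inner_def : ∀ x y : α.AlgCrossedProduct, inner A x y = coeffOne α (y * star x) :=
    fun _ _ => rfl
  have norm_sq : ∀ x : α.AlgCrossedProduct, ‖x‖ ^ 2 = ‖coeffOne α (x * star x)‖ :=
    fun x => CStarModule.norm_sq_eq A
  have bound : ∀ b : α.AlgCrossedProduct, ∃ C : ℝ, 0 ≤ C ∧ ∀ x, ‖x * b‖ ≤ C * ‖x‖ := by
    intro b
    induction b using induction with
    | h0 => exact ⟨0, le_rfl, fun x => by rw [mul_zero, norm_zero, zero_mul]⟩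
    | hadd b b' hb hb' =>
      obtain ⟨C, hC, hb⟩ := hb
      obtain ⟨D, hD, hb'⟩ := hb'
      refine ⟨C + D, add_nonneg hC hD, fun x => ?_⟩
      rw [mul_add, add_mul]
      exact (norm_add_le _ _).trans (add_le_add (hb x) (hb' x))
    | hδ g a =>
      refine ⟨‖(a : A)‖, norm_nonneg _, fun x => ?_⟩
      obtain ⟨c, b, hc, hb⟩ := exists_completion_square (a : A)
      have h1 : (x * δ α g a) * star (x * δ α g a) =
          x * ι α ((a : A) * star (a : A)) * star x := by
        rw [star_mul, mul_assoc, ← mul_assoc (δ α g a), δ_mul_star_δ, mul_assoc]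
      have h2 : (c • x + x * ι α b) * star (c • x + x * ι α b) =
          ((‖(a : A)‖ ^ 2 : ℝ) : ℂ) • (x * star x) -
            x * ι α ((a : A) * star (a : A)) * star x := by
        have : x * ι α ((a : A) * star (a : A)) * star x =
            -(x * ι α (-((a : A) * star (a : A))) * star x) := by
          rw [map_neg, mul_neg, neg_mul, neg_neg]
        rw [this, ← hb, ← hc]
        simp only [star_add, star_smul, star_mul, map_add, map_smul, map_mul, map_star, mul_add,
          add_mul, smul_mul_assoc, mul_smul_comm, mul_assoc, smul_add]
        rw [mul_comm c (star c), mul_smul]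
        abel
      have h3 := nonneg (c • x + x * ι α b)
      rw [h2, map_sub, map_smul, sub_nonneg, ← h1] at h3
      have h4 := CStarAlgebra.norm_le_norm_of_nonneg_of_le (nonneg _) h3
      rw [norm_smul, ← norm_sq, ← norm_sq, Complex.norm_real, Real.norm_of_nonneg (sq_nonneg _),
        ← mul_pow] at h4
      exact (pow_le_pow_iff_left₀ (norm_nonneg _) (by positivity) two_ne_zero).mp h4
  let T₀ : α.AlgCrossedProduct → (α.AlgCrossedProduct →L[ℂ] α.AlgCrossedProduct) := fun b =>
    LinearMap.mkContinuousOfExistsBound ((mulₗ α).flip b)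
      (by obtain ⟨C, -, hC⟩ := bound b; exact ⟨C, hC⟩)
  let T : α.AlgCrossedProduct →ₗ[ℂ] (α.AlgCrossedProduct →L[ℂ] α.AlgCrossedProduct) :=
    { toFun := T₀
      map_add' := fun b b' => by
        ext1 x
        exact mul_add x b b'
      map_smul' := fun c b => by
        ext1 x
        exact mul_smul_comm c x b }
  have hT : ∀ b x, T b x = x * b := fun _ _ => rfl
  have mul_le : ∀ b b', ‖T (b * b')‖ ≤ ‖T b‖ * ‖T b'‖ := by
    intro b b'
    rw [mul_comm]
    refine le_trans (le_of_eq ?_) (ContinuousLinearMap.opNorm_comp_le (T b') (T b))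
    congr 1
    ext1 x
    exact (mul_assoc x b b').symm
  have sq_le : ∀ b, ‖T b‖ ^ 2 ≤ ‖T (b * star b)‖ := by
    intro b
    rw [← Real.le_sqrt (norm_nonneg _) (norm_nonneg _)]
    refine ContinuousLinearMap.opNorm_le_bound _ (Real.sqrt_nonneg _) fun x => ?_
    rw [hT]
    refine (pow_le_pow_iff_left₀ (norm_nonneg _) (by positivity) two_ne_zero).mp ?_
    rw [mul_pow, Real.sq_sqrt (norm_nonneg _), norm_sq, star_mul]
    have : x * b * (star b * star x) = T (b * star b) x * star x := by
      rw [hT]; simp only [mul_assoc]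
    rw [this, ← inner_def]
    refine (CStarModule.norm_inner_le _).trans ?_
    calc ‖x‖ * ‖T (b * star b) x‖ ≤ ‖x‖ * (‖T (b * star b)‖ * ‖x‖) := by
          gcongr; exact ContinuousLinearMap.le_opNorm _ _
      _ = _ := by ring
  have star_le : ∀ b, ‖T b‖ ≤ ‖T (star b)‖ := by
    intro b
    have h := (sq_le b).trans (mul_le b (star b))
    rw [sq] at h
    rcases (norm_nonneg (T b)).eq_or_lt with h0 | h0
    · rw [← h0]; exact norm_nonneg _
    · exact le_of_mul_le_mul_left h h0
  have star_eq : ∀ b, ‖T (star b)‖ = ‖T b‖ := fun b =>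
    le_antisymm (by simpa using star_le (star b)) (star_le b)
  refine ⟨{ toSeminorm := (normSeminorm ℂ _).comp T
            mul_le' := mul_le
            star_eq' := star_eq
            star_mul_self_eq' := fun b => ?_ }, fun b => ?_⟩
  · change ‖T (star b * b)‖ = ‖T b‖ ^ 2
    refine le_antisymm ((mul_le _ _).trans_eq (by rw [star_eq, sq])) ?_
    simpa [star_eq] using sq_le (star b)
  · change ‖coeffOne α b‖ ≤ ‖T b‖
    set c := coeffOne α b with hc
    have normι : ∀ d : A, ‖ι α d‖ = ‖d‖ := fun d => by
      rw [← sq_eq_sq₀ (norm_nonneg _) (norm_nonneg _), norm_sq, ← map_star, ← map_mul,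
        coeffOne_ι, CStarRing.norm_self_mul_star, sq]
    have h1 : inner A (ι α c) (T b (ι α (star c))) = star c * c * star c := by
      rw [inner_def, hT, ← map_star (ι α), coeffOne_mul_ι, coeffOne_ι_mul]
    have h2 : ‖star c * c * star c‖ ≤ ‖c‖ * (‖T b‖ * ‖c‖) := by
      rw [← h1]
      refine (CStarModule.norm_inner_le _).trans ?_
      rw [normι]
      gcongr
      refine (ContinuousLinearMap.le_opNorm _ _).trans_eq ?_
      rw [normι, norm_star]
    have h3 : ‖c‖ ^ 4 ≤ ‖star c * c * star c‖ * ‖c‖ := by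
      refine le_trans (le_of_eq ?_) (norm_mul_le _ _)
      have : star c * c * star c * c = star (star c * c) * (star c * c) := by
        simp only [star_mul, star_star, mul_assoc]
      rw [this, CStarRing.norm_star_mul_self, CStarRing.norm_star_mul_self]
      ring
    rcases (norm_nonneg c).eq_or_lt with h0 | h0
    · rw [← h0]; exact norm_nonneg _
    · have h4 : ‖c‖ ^ 3 * ‖c‖ ≤ ‖c‖ ^ 3 * ‖T b‖ := by
        calc _ = ‖c‖ ^ 4 := by ring
          _ ≤ _ := h3
          _ ≤ (‖c‖ * (‖T b‖ * ‖c‖)) * ‖c‖ := by gcongr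
          _ = _ := by ring
      exact le_of_mul_le_mul_left h4 (by positivity)

end RegularModule

lemma norm_coeffOne_le (x : α.AlgCrossedProduct) :
    ‖coeffOne α x‖ ≤ (maxSeminorm α).toSeminorm x := by
  obtain ⟨p, hp⟩ := exists_seminorm_coeffOne_le (α := α)
  exact (hp x).trans (le_maxSeminorm p x)

end AlgCrossedProduct

end PartialAction

namespace PartialAction

variable {G : Type*} [Group G]

section CrossedProduct

variable {A : Type*} [NonUnitalCStarAlgebra A] (α : PartialAction G A)

/-- The partial crossed product `A ⋊_α G`: the completion of the algebraic crossed product in the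
maximal norm. -/
def CrossedProduct : Type _ := (AlgCrossedProduct.maxSeminorm α).Compl

namespace CrossedProduct

noncomputable instance : NonUnitalCStarAlgebra α.CrossedProduct :=
  inferInstanceAs (NonUnitalCStarAlgebra (AlgCrossedProduct.maxSeminorm α).Compl)

/-- The canonical map from the algebraic crossed product to the crossed product. -/
noncomputable def ofAlg : α.AlgCrossedProduct →⋆ₙₐ[ℂ] α.CrossedProduct :=
  (AlgCrossedProduct.maxSeminorm α).toCompl

lemma denseRange_ofAlg : DenseRange (ofAlg α) :=
  (AlgCrossedProduct.maxSeminorm α).denseRange_toCompl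

lemma norm_ofAlg (x : α.AlgCrossedProduct) : ‖ofAlg α x‖ =
    ⨆ p : CStarSeminorm α.AlgCrossedProduct, p.toSeminorm x :=
  (AlgCrossedProduct.maxSeminorm α).norm_toCompl x

/-- The element `a δ_g` of the crossed product. -/
noncomputable def δ (g : G) (a : α.dom g) : α.CrossedProduct :=
  ofAlg α (AlgCrossedProduct.δ α g a)

/-- The canonical conditional expectation `E : A ⋊_α G → A`, the continuous extension of
`∑ a_g δ_g ↦ a_e`. -/
noncomputable def condExp : α.CrossedProduct →L[ℂ] A :=
  (AlgCrossedProduct.maxSeminorm α).extendL (AlgCrossedProduct.coeffOne α)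
    AlgCrossedProduct.norm_coeffOne_le

open scoped Classical in
lemma condExp_δ (g : G) (a : α.dom g) : condExp α (δ α g a) = if g = 1 then (a : A) else 0 :=
  ((AlgCrossedProduct.maxSeminorm α).extendL_toCompl (AlgCrossedProduct.coeffOne α)
    AlgCrossedProduct.norm_coeffOne_le _).trans (AlgCrossedProduct.coeffOne_δ g a)

end CrossedProduct

end CrossedProduct

section Equivariant

variable {A : Type*} [NonUnitalCStarAlgebra A] {B : Type*} [NonUnitalCStarAlgebra B]

/-- A ⋆-homomorphism `φ : A → B` is `G`-equivariant if `φ(A_g) ⊆ B_g` and `φ ∘ α_g = β_g ∘ φ` on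
`A_{g⁻¹}`, for all `g`. -/
structure IsEquivariant (α : PartialAction G A) (β : PartialAction G B) (φ : A →⋆ₙₐ[ℂ] B) :
    Prop where
  map_mem : ∀ (g : G) {a : A}, a ∈ α.dom g → φ a ∈ β.dom g
  map_map : ∀ (g : G) (a : α.dom g⁻¹), φ (α.map g a) = β.map g ⟨φ a, map_mem g⁻¹ a.2⟩

variable {α : PartialAction G A} {β : PartialAction G B} {φ : A →⋆ₙₐ[ℂ] B}

lemma IsEquivariant.map_act (hφ : α.IsEquivariant β φ) {g : G} {a : A} (ha : a ∈ α.dom g⁻¹) :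
    φ (α.act g a) = β.act g (φ a) := by
  rw [α.act_of_mem ha, β.act_of_mem (hφ.map_mem _ ha), hφ.map_map g ⟨a, ha⟩]

namespace AlgCrossedProduct

/-- The map `∑ a_g δ_g ↦ ∑ φ(a_g) δ_g`, as a linear map. -/
noncomputable def mapₗ (hφ : α.IsEquivariant β φ) :
    α.AlgCrossedProduct →ₗ[ℂ] β.AlgCrossedProduct :=
  lift α fun g => (δ β g).comp
    ({ toFun := fun a => ⟨φ a, hφ.map_mem g a.2⟩
       map_add' := fun a b => Subtype.ext (map_add φ (a : A) (b : A))
       map_smul' := fun c a => Subtype.ext (map_smul φ c (a : A)) } : α.dom g →ₗ[ℂ] β.dom g)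

lemma mapₗ_δ (hφ : α.IsEquivariant β φ) (g : G) (a : α.dom g) :
    mapₗ hφ (δ α g a) = δ β g ⟨φ a, hφ.map_mem g a.2⟩ :=
  lift_δ _ g a

/-- The ⋆-homomorphism `∑ a_g δ_g ↦ ∑ φ(a_g) δ_g`. -/
noncomputable def map (hφ : α.IsEquivariant β φ) :
    α.AlgCrossedProduct →⋆ₙₐ[ℂ] β.AlgCrossedProduct where
  toFun := mapₗ hφ
  map_smul' := map_smul (mapₗ hφ)
  map_zero' := map_zero (mapₗ hφ)
  map_add' := map_add (mapₗ hφ)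
  map_mul' x y := by
    induction x using AlgCrossedProduct.induction with
    | h0 => simp only [zero_mul, map_zero]
    | hadd x x' hx hx' => simp only [add_mul, map_add, hx, hx']
    | hδ g a =>
      induction y using AlgCrossedProduct.induction with
      | h0 => simp only [mul_zero, map_zero]
      | hadd y y' hy hy' => simp only [mul_add, map_add, hy, hy']
      | hδ h b =>
        simp only [δ_mul_δ, mapₗ_δ]
        refine δ_congr rfl ?_
        simp only [coe_fiberMul]
        rw [hφ.map_act (α.mul_mem_right _ _ (α.act_mem _ _)), map_mul,
          hφ.map_act (α.mem_inv_inv a.2)]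
  map_star' x := by
    induction x using AlgCrossedProduct.induction with
    | h0 => simp only [star_zero, map_zero]
    | hadd x y hx hy => simp only [star_add, map_add, hx, hy]
    | hδ g a =>
      simp only [star_δ, mapₗ_δ]
      refine δ_congr rfl ?_
      simp only [coe_fiberStar]
      rw [hφ.map_act (α.mem_inv_inv (star_mem a.2)), map_star]

end AlgCrossedProduct

/-- The ⋆-homomorphism `A ⋊_α G → B ⋊_β G`, `a δ_g ↦ φ(a) δ_g`, induced by a `G`-equivariant
⋆-homomorphism `φ : A → B`. -/
noncomputable def CrossedProduct.map (hφ : α.IsEquivariant β φ) :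
    α.CrossedProduct →⋆ₙₐ[ℂ] β.CrossedProduct :=
  (AlgCrossedProduct.maxSeminorm α).extend
    ((CrossedProduct.ofAlg β).comp (AlgCrossedProduct.map hφ)) fun x =>
      ((AlgCrossedProduct.maxSeminorm β).norm_toCompl _).trans_le
        (AlgCrossedProduct.le_maxSeminorm
          ((AlgCrossedProduct.maxSeminorm β).comp (AlgCrossedProduct.map hφ)) x)

lemma CrossedProduct.map_δ (hφ : α.IsEquivariant β φ) (g : G) (a : α.dom g) :
    CrossedProduct.map hφ (CrossedProduct.δ α g a) =
      CrossedProduct.δ β g ⟨φ a, hφ.map_mem g a.2⟩ :=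
  ((AlgCrossedProduct.maxSeminorm α).extend_toCompl _ _ _).trans
    (congrArg (CrossedProduct.ofAlg β) (AlgCrossedProduct.mapₗ_δ hφ g a))

end Equivariant

/-- A functional `τ` on `A` is `G`-invariant if `τ(a) = τ(α_{g⁻¹}(a))` for all `g` and all
`a ∈ A_g`. -/
def IsInvariant {A : Type*} [NonUnitalCStarAlgebra A] (α : PartialAction G A) (τ : A →L[ℂ] ℂ) :
    Prop :=
  ∀ (g : G) (a : A) (ha : a ∈ α.dom g), τ a = τ (α.map g⁻¹ ⟨a, α.mem_inv_inv ha⟩)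

end PartialAction

/-- An inductive limit of a sequence of C⋆-algebras, by its universal property in the category of
C⋆-algebras and ⋆-homomorphisms. -/
structure IsInductiveLimit {A : ℕ → Type u} [∀ i, NonUnitalCStarAlgebra (A i)]
    (φ : ∀ i, A i →⋆ₙₐ[ℂ] A (i + 1)) {L : Type u} [NonUnitalCStarAlgebra L]
    (μ : ∀ i, A i →⋆ₙₐ[ℂ] L) : Prop where
  compatible : ∀ i, (μ (i + 1)).comp (φ i) = μ i
  existsUnique_desc : ∀ (B : Type u) [NonUnitalCStarAlgebra B] (ν : ∀ i, A i →⋆ₙₐ[ℂ] B),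
    (∀ i, (ν (i + 1)).comp (φ i) = ν i) → ∃! θ : L →⋆ₙₐ[ℂ] B, ∀ i, θ.comp (μ i) = ν i

/-- The inductive limit partial action on `L = lim A_i`: its ideals are the inductive limits
`L_g = closure (⋃ i, μ_i(A_{i,g}))` of the ideals `A_{i,g}`, and its isomorphisms are the inductive
limits of those of the `α_i`, that is, `β_g ∘ μ_i = μ_i ∘ α_{i,g}` on `A_{i,g⁻¹}`. -/
structure IsInductiveLimitAction {G : Type*} [Group G] {A : ℕ → Type*}
    [∀ i, NonUnitalCStarAlgebra (A i)] (α : ∀ i, PartialAction G (A i))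
    {L : Type*} [NonUnitalCStarAlgebra L] (μ : ∀ i, A i →⋆ₙₐ[ℂ] L) (β : PartialAction G L) :
    Prop where
  dom_eq : ∀ g, (β.dom g : Set L) = closure (⋃ i, μ i '' ((α i).dom g : Set (A i)))
  equivariant : ∀ i, (α i).IsEquivariant β (μ i)

open scoped ComplexOrder in
/-- A tracial state: a positive functional of norm one with `τ(ab) = τ(ba)`. -/
structure IsTracialState {A : Type*} [NonUnitalCStarAlgebra A] (τ : A →L[ℂ] ℂ) : Prop where
  nonneg : ∀ a, 0 ≤ τ (star a * a)
  norm_eq_one : ‖τ‖ = 1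
  map_mul_comm : ∀ a b, τ (a * b) = τ (b * a)

/-- An inductive sequence of tracial states `τ_i` on the C⋆-algebras of an inductive sequence. -/
structure IsTracialSequence {A : ℕ → Type*} [∀ i, NonUnitalCStarAlgebra (A i)]
    (φ : ∀ i, A i →⋆ₙₐ[ℂ] A (i + 1)) (τ : ∀ i, A i →L[ℂ] ℂ) : Prop where
  isTracialState : ∀ i, IsTracialState (τ i)
  compatible : ∀ i (a : A i), τ (i + 1) (φ i a) = τ i a

/-- The tracial state `σ` on `L` is the inductive limit of the `τ_i`. -/
structure IsLimitTrace {A : ℕ → Type*} [∀ i, NonUnitalCStarAlgebra (A i)]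
    {L : Type*} [NonUnitalCStarAlgebra L] (μ : ∀ i, A i →⋆ₙₐ[ℂ] L)
    (τ : ∀ i, A i →L[ℂ] ℂ) (σ : L →L[ℂ] ℂ) : Prop where
  isTracialState : IsTracialState σ
  map_eq : ∀ i (a : A i), σ (μ i a) = τ i a

/-!
Everything reduces to two consequences of the universal property of an inductive limit `(L, μ)` of
C⋆-algebras. The union of the `μ_i(A_i)` is dense, as `L` maps to its closure
(`IsInductiveLimit.dense_iUnion_range`), and `‖μ_i(a)‖` dominates every compatible family of
functions dominated by the norms of the `A_i` (`IsInductiveLimit.le_norm_of_compatible`). For the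
latter, the universal property is tested on a model of the limit: the completion of the eventually
coherent sequences in `∏ A_j` in the seminorm `lim ‖x_j‖`. This model lies in the universe of the
`A_i`, while the conclusion holds for families with values in any universe; this matters because the
group `G` may live in a larger one than the algebras.

Hence compatible contractive linear maps on the `A_i` extend uniquely to the limit, which settles
existence and uniqueness of limit traces for every inductive limit
(`IsInductiveLimit.existsUnique_isLimitTrace`).

For the crossed products, a compatible family of ⋆-homomorphisms `ν_i` from the `A_i ⋊ G` to `B`
satisfies `‖ν_i(a δ_g)‖ ≤ ‖μ_i(a)‖`, by the C⋆-identity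
`(a δ_g)(a δ_g)* = a a* δ_e` and the maximality of the norm of `L`. So `μ_i(a) ↦ ν_i(a δ_g)` extends
to each ideal `L_g`, and these extensions form a ⋆-homomorphism on the formal sums, hence on
`L ⋊ G` (`IsInductiveLimitAction.isInductiveLimit_crossedProduct`). Together with the fact that
`τ ∘ E` is a tracial state for an invariant tracial state `τ`
(`PartialAction.CrossedProduct.isTracialState_comp_condExp`) and `E ∘ λ_i = μ_i ∘ E_i`, this makes
the general result on limit traces applicable to the crossed products; finally
`(lim τ_i) ∘ E` and `lim (τ_i ∘ E_i)` agree on the dense union of the images of the `λ_i`.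
-/

/-! ### Extending compatible families of linear maps by continuity -/

/-- A compatible sequence of linear maps `n_i : D_i → B` which is dominated in norm by a compatible
sequence `m_i : D_i → E` with dense union of ranges factors through a contraction `E → B`. -/
theorem exists_continuousLinearMap_of_dense {D : ℕ → Type*} [∀ i, AddCommGroup (D i)]
    [∀ i, Module ℂ (D i)] {E B : Type*} [NormedAddCommGroup E] [NormedSpace ℂ E]
    [NormedAddCommGroup B] [NormedSpace ℂ B] [CompleteSpace B]
    (t : ∀ i, D i → D (i + 1)) (m : ∀ i, D i →ₗ[ℂ] E) (n : ∀ i, D i →ₗ[ℂ] B)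
    (hm : ∀ i d, m (i + 1) (t i d) = m i d) (hn : ∀ i d, n (i + 1) (t i d) = n i d)
    (hdense : Dense (⋃ i, Set.range (m i))) (hle : ∀ i d, ‖n i d‖ ≤ ‖m i d‖) :
    ∃ F : E →L[ℂ] B, (∀ i d, F (m i d) = n i d) ∧ ∀ x, ‖F x‖ ≤ ‖x‖ := by
  -- The union of the ranges of `d ↦ (m_i d, n_i d)` is the graph of the map to be extended.
  let Γ : ℕ → Submodule ℂ (E × B) := fun i => LinearMap.range ((m i).prod (n i))
  have hΓ : Monotone Γ := monotone_nat_of_le_succ fun i => by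
    rintro _ ⟨d, rfl⟩
    exact ⟨t i d, Prod.ext (hm i d) (hn i d)⟩
  have hmem : ∀ {z : E × B}, z ∈ ⨆ i, Γ i ↔ ∃ i, z ∈ Γ i :=
    Submodule.mem_iSup_of_directed Γ hΓ.directed_le
  let e : ↥(⨆ i, Γ i) →ₗ[ℂ] E := LinearMap.fst ℂ E B ∘ₗ (⨆ i, Γ i).subtype
  let f : ↥(⨆ i, Γ i) →ₗ[ℂ] B := LinearMap.snd ℂ E B ∘ₗ (⨆ i, Γ i).subtype
  have hpt : ∀ i (d : D i), (m i d, n i d) ∈ ⨆ i, Γ i := fun i d => hmem.mpr ⟨i, d, rfl⟩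
  have he : DenseRange e := hdense.mono <| by
    rintro _ ⟨_, ⟨i, rfl⟩, d, rfl⟩
    exact ⟨⟨_, hpt i d⟩, rfl⟩
  have hfe : ∀ z, ‖f z‖ ≤ 1 * ‖e z‖ := by
    rintro ⟨z, hz⟩
    obtain ⟨i, d, rfl⟩ := hmem.mp hz
    simpa [f, e] using hle i d
  refine ⟨f.extendOfNorm e, fun i d => ?_, fun x => ?_⟩
  · exact LinearMap.extendOfNorm_eq he ⟨1, hfe⟩ ⟨_, hpt i d⟩
  · simpa using LinearMap.norm_extendOfNorm_apply_le he 1 hfe x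

/-- Relations between two points of a dense increasing union which are closed in both arguments
can be checked on pairs coming from a common stage. -/
theorem forall₂_of_dense_iUnion {X Y : Type*} [TopologicalSpace X] [TopologicalSpace Y]
    {S : ℕ → Set X} {T : ℕ → Set Y} (hS : Monotone S) (hT : Monotone T)
    (hSd : Dense (⋃ i, S i)) (hTd : Dense (⋃ i, T i)) {P : X → Y → Prop}
    (hP : IsClosed {z : X × Y | P z.1 z.2}) (h : ∀ i, ∀ x ∈ S i, ∀ y ∈ T i, P x y) (x : X) (y : Y) :
    P x y := by
  have hsub : (⋃ i, S i) ×ˢ (⋃ i, T i) ⊆ {z : X × Y | P z.1 z.2} := by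
    rintro ⟨x, y⟩ ⟨hx, hy⟩
    obtain ⟨i, hi⟩ := Set.mem_iUnion.mp hx
    obtain ⟨j, hj⟩ := Set.mem_iUnion.mp hy
    exact h (max i j) x (hS (le_max_left i j) hi) y (hT (le_max_right i j) hj)
  exact (hP.closure_subset_iff.mpr hsub) ((hSd.prod hTd) (x, y))

/-! ### Inductive limits of C⋆-algebras -/

section InductiveLimit

variable {A : ℕ → Type u} [∀ i, NonUnitalCStarAlgebra (A i)]
  (φ : ∀ i, A i →⋆ₙₐ[ℂ] A (i + 1))

theorem monotone_range_of_compatible {X : ℕ → Type*} {Y : Type*} {t : ∀ i, X i → X (i + 1)}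
    {m : ∀ i, X i → Y} (hm : ∀ i x, m (i + 1) (t i x) = m i x) :
    Monotone fun i => Set.range (m i) :=
  monotone_nat_of_le_succ fun i => by
    rintro _ ⟨x, rfl⟩
    exact ⟨t i x, hm i x⟩

/-- The connecting map `A_i → A_j` of the inductive sequence, for `i ≤ j`. -/
def connect {i j : ℕ} (h : i ≤ j) : A i →⋆ₙₐ[ℂ] A j :=
  Nat.leRecOn (C := fun j => A i →⋆ₙₐ[ℂ] A j) h (fun {k} f => (φ k).comp f)
    (NonUnitalStarAlgHom.id ℂ (A i))

theorem connect_self (i : ℕ) (a : A i) : connect φ le_rfl a = a := by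
  rw [connect, Nat.leRecOn_self]
  rfl

theorem connect_succ {i j : ℕ} (h : i ≤ j) (a : A i) :
    connect φ (h.trans j.le_succ) a = φ j (connect φ h a) := by
  rw [connect, Nat.leRecOn_succ h]
  rfl

theorem connect_map {i j : ℕ} (h : i + 1 ≤ j) (a : A i) :
    connect φ h (φ i a) = connect φ ((Nat.le_succ i).trans h) a := by
  induction j, h using Nat.le_induction with
  | base => rw [connect_self, connect_succ φ le_rfl, connect_self]
  | succ j h ih => rw [connect_succ φ h, connect_succ φ ((Nat.le_succ i).trans h), ih]

/-- The sequences `(x_j)` in `∏ A_j` with `x_{j+1} = φ_j(x_j)` for all large `j`. Modulo the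
sequences of norm tending to `0`, they form the algebraic inductive limit. -/
def eventuallyCoherent : NonUnitalStarSubalgebra ℂ (∀ j, A j) where
  carrier := {x | ∀ᶠ j in Filter.atTop, x (j + 1) = φ j (x j)}
  add_mem' {x y} hx hy := by
    filter_upwards [hx, hy] with j h h'
    simp [h, h']
  zero_mem' := Filter.Eventually.of_forall fun j => by simp
  mul_mem' {x y} hx hy := by
    filter_upwards [hx, hy] with j h h'
    simp [h, h']
  smul_mem' c {x} hx := by
    filter_upwards [hx] with j h
    simp [h]
  star_mem' {x} hx := by
    filter_upwards [hx] with j h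
    simp [h, map_star]

theorem exists_tendsto_norm (x : eventuallyCoherent φ) :
    ∃ l : ℝ, Filter.Tendsto (fun j => ‖(x : ∀ j, A j) j‖) Filter.atTop (nhds l) := by
  obtain ⟨N, hN⟩ := Filter.eventually_atTop.mp x.2
  have hanti : Antitone fun k => ‖(x : ∀ j, A j) (k + N)‖ := antitone_nat_of_succ_le fun k => by
    rw [Nat.add_right_comm, hN (k + N) (Nat.le_add_left N k)]
    exact NonUnitalStarAlgHom.norm_apply_le _ _
  refine ⟨_, (Filter.tendsto_add_atTop_iff_nat N).mp (tendsto_atTop_ciInf hanti ⟨0, ?_⟩)⟩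
  rintro _ ⟨k, rfl⟩
  exact norm_nonneg _

/-- The limit of the norms of an eventually coherent sequence. -/
noncomputable def limNorm (x : eventuallyCoherent φ) : ℝ := (exists_tendsto_norm φ x).choose

theorem tendsto_limNorm (x : eventuallyCoherent φ) :
    Filter.Tendsto (fun j => ‖(x : ∀ j, A j) j‖) Filter.atTop (nhds (limNorm φ x)) :=
  (exists_tendsto_norm φ x).choose_spec

/-- The limit of the norms, as a C⋆-seminorm. Its Hausdorff completion is a model of the inductive
limit living in the universe of the `A_i`. -/
noncomputable def limSeminorm : CStarSeminorm (eventuallyCoherent φ) where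
  toSeminorm := Seminorm.of (limNorm φ)
    (fun x y => le_of_tendsto_of_tendsto' (tendsto_limNorm φ (x + y))
      ((tendsto_limNorm φ x).add (tendsto_limNorm φ y)) fun j => norm_add_le _ _)
    (fun c x => tendsto_nhds_unique (tendsto_limNorm φ (c • x))
      (((tendsto_limNorm φ x).const_mul ‖c‖).congr fun j => (norm_smul _ _).symm))
  mul_le' x y := le_of_tendsto_of_tendsto' (tendsto_limNorm φ (x * y))
    ((tendsto_limNorm φ x).mul (tendsto_limNorm φ y)) fun j => norm_mul_le _ _
  star_eq' x := tendsto_nhds_unique (tendsto_limNorm φ (star x))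
    ((tendsto_limNorm φ x).congr fun j => (norm_star _).symm)
  star_mul_self_eq' x := tendsto_nhds_unique (tendsto_limNorm φ (star x * x))
    (((tendsto_limNorm φ x).pow 2).congr fun j => by
      rw [sq]; exact CStarRing.norm_star_mul_self.symm)

/-- The eventually coherent sequence `(0, …, 0, a, φ_i(a), φ_{i+1}(φ_i(a)), …)`. -/
def coherentSeq (i : ℕ) : A i →⋆ₙₐ[ℂ] eventuallyCoherent φ :=
  NonUnitalStarAlgHom.codRestrict
    ({ toFun := fun a j => if h : i ≤ j then connect φ h a else 0
       map_smul' := fun c a => by ext j; by_cases h : i ≤ j <;> simp [h]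
       map_zero' := by ext j; by_cases h : i ≤ j <;> simp [h]
       map_add' := fun a b => by ext j; by_cases h : i ≤ j <;> simp [h]
       map_mul' := fun a b => by ext j; by_cases h : i ≤ j <;> simp [h]
       map_star' := fun a => by ext j; by_cases h : i ≤ j <;> simp [h, map_star] } :
      A i →⋆ₙₐ[ℂ] ∀ j, A j) _ fun a => by
    filter_upwards [Filter.eventually_ge_atTop i] with j h
    change dite _ _ _ = φ j (dite _ _ _)
    rw [dif_pos (h.trans j.le_succ), dif_pos h, connect_succ]

theorem coherentSeq_apply {i j : ℕ} (h : i ≤ j) (a : A i) :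
    (coherentSeq φ i a : ∀ j, A j) j = connect φ h a :=
  dif_pos h

theorem limNorm_coherentSeq_map_sub (i : ℕ) (a : A i) :
    limNorm φ (coherentSeq φ (i + 1) (φ i a) - coherentSeq φ i a) = 0 := by
  refine tendsto_nhds_unique (tendsto_limNorm φ _) (tendsto_const_nhds.congr' ?_)
  filter_upwards [Filter.eventually_ge_atTop (i + 1)] with j h
  change 0 = ‖(coherentSeq φ (i + 1) (φ i a) : ∀ j, A j) j - (coherentSeq φ i a : ∀ j, A j) j‖
  rw [coherentSeq_apply φ h, coherentSeq_apply φ ((Nat.le_succ i).trans h), connect_map, sub_self,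
    norm_zero]

namespace IsInductiveLimit

variable {φ} {L : Type u} [NonUnitalCStarAlgebra L] {μ : ∀ i, A i →⋆ₙₐ[ℂ] L}

theorem map_apply (hμ : IsInductiveLimit φ μ) (i : ℕ) (a : A i) : μ (i + 1) (φ i a) = μ i a :=
  DFunLike.congr_fun (hμ.compatible i) a

theorem monotone_range (hμ : IsInductiveLimit φ μ) : Monotone fun i => Set.range (μ i) :=
  monotone_range_of_compatible (t := fun i => φ i) hμ.map_apply

/-- By uniqueness, the universal map into the closure of the union of the ranges, followed by the
inclusion, is the identity. -/
theorem dense_iUnion_range (hμ : IsInductiveLimit φ μ) : Dense (⋃ i, Set.range (μ i)) := by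
  have hdir : Directed (· ≤ ·) fun i => NonUnitalStarAlgHom.range (μ i) :=
    directed_of_isDirected_le (hμ.monotone_range)
  have hU := NonUnitalStarSubalgebra.coe_iSup_of_directed hdir
  let C := (⨆ i, NonUnitalStarAlgHom.range (μ i)).topologicalClosure
  have : IsClosed (C : Set L) := NonUnitalStarSubalgebra.isClosed_topologicalClosure _
  have hmem : ∀ i a, μ i a ∈ C := fun i a => NonUnitalStarSubalgebra.le_topologicalClosure _
    ((le_iSup (fun i => NonUnitalStarAlgHom.range (μ i)) i) ⟨a, rfl⟩)
  obtain ⟨θ, hθ, -⟩ := hμ.existsUnique_desc C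
    (fun i => NonUnitalStarAlgHom.codRestrict (μ i) C (hmem i)) fun i => by
      ext a
      exact hμ.map_apply i a
  have hid : (NonUnitalStarSubalgebraClass.subtype C).comp θ = NonUnitalStarAlgHom.id ℂ L :=
    (hμ.existsUnique_desc L μ hμ.compatible).unique (fun i => by
      ext a
      exact congrArg Subtype.val (DFunLike.congr_fun (hθ i) a)) fun i => rfl
  intro x
  have hx : x ∈ C := by
    have h : (θ x : L) = x := DFunLike.congr_fun hid x
    exact h ▸ (θ x).2
  exact (congrArg closure hU).subset hx

/-- The norm of `μ_i(a)` is the largest possible one: it dominates `q_i(a)` for every compatible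
family of functions `q_i` dominated by the norms. This is seen on the model `limSeminorm`, where
the norm of the class of `a` is `lim_j ‖φ_{ij}(a)‖`. -/
theorem le_norm_of_compatible (hμ : IsInductiveLimit φ μ) (q : ∀ i, A i → ℝ)
    (hq : ∀ i a, q i a ≤ ‖a‖) (hqφ : ∀ i a, q (i + 1) (φ i a) = q i a) (i : ℕ) (a : A i) :
    q i a ≤ ‖μ i a‖ := by
  let p := limSeminorm φ
  obtain ⟨θ, hθ, -⟩ := hμ.existsUnique_desc p.Compl
    (fun i => p.toCompl.comp (coherentSeq φ i)) fun i => by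
      ext a
      change p.toCompl (coherentSeq φ (i + 1) (φ i a)) = p.toCompl (coherentSeq φ i a)
      rw [← sub_eq_zero, ← map_sub, ← norm_eq_zero, p.norm_toCompl]
      exact limNorm_coherentSeq_map_sub φ i a
  have h : p.toCompl (coherentSeq φ i a) = θ (μ i a) := (DFunLike.congr_fun (hθ i) a).symm
  refine le_trans ?_ (NonUnitalStarAlgHom.norm_apply_le θ (μ i a))
  rw [← h, p.norm_toCompl]
  refine ge_of_tendsto (tendsto_limNorm φ (coherentSeq φ i a)) ?_
  filter_upwards [Filter.eventually_ge_atTop i] with j hj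
  rw [coherentSeq_apply φ hj]
  refine le_trans (le_of_eq ?_) (hq j _)
  induction j, hj using Nat.le_induction with
  | base => rw [connect_self]
  | succ j hj ih => rw [connect_succ φ hj, hqφ, ih]

/-- Contractive compatible families of linear maps on the `A_i` factor through the limit. -/
theorem exists_continuousLinearMap (hμ : IsInductiveLimit φ μ) {B : Type*} [NormedAddCommGroup B]
    [NormedSpace ℂ B] [CompleteSpace B] (n : ∀ i, A i →L[ℂ] B) (hn : ∀ i, ‖n i‖ ≤ 1)
    (hnφ : ∀ i a, n (i + 1) (φ i a) = n i a) :
    ∃ F : L →L[ℂ] B, (∀ i a, F (μ i a) = n i a) ∧ ∀ x, ‖F x‖ ≤ ‖x‖ := by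
  refine exists_continuousLinearMap_of_dense (fun i => φ i)
    (fun i => LinearMapClass.linearMap (μ i)) (fun i => (n i : A i →ₗ[ℂ] B)) hμ.map_apply hnφ
    hμ.dense_iUnion_range ?_
  exact hμ.le_norm_of_compatible (fun i a => ‖n i a‖)
    (fun i a => ((n i).le_of_opNorm_le (hn i) a).trans_eq (one_mul _))
    (fun i a => by rw [hnφ])

/-- Continuous maps out of an inductive limit are determined by their values on the `A_i`. -/
theorem continuous_ext (hμ : IsInductiveLimit φ μ) {X : Type*} [TopologicalSpace X] [T2Space X]
    {f g : L → X} (hf : Continuous f) (hg : Continuous g)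
    (h : ∀ i a, f (μ i a) = g (μ i a)) : f = g :=
  hf.ext_on hμ.dense_iUnion_range hg <| by
    rintro _ ⟨_, ⟨i, rfl⟩, a, rfl⟩
    exact h i a

open scoped ComplexOrder in
/-- The limit of an inductive sequence of tracial states exists and is unique. -/
theorem existsUnique_isLimitTrace (hμ : IsInductiveLimit φ μ) {τ : ∀ i, A i →L[ℂ] ℂ}
    (hτ : IsTracialSequence φ τ) : ∃! σ : L →L[ℂ] ℂ, IsLimitTrace μ τ σ := by
  obtain ⟨σ, hσ, hle⟩ := hμ.exists_continuousLinearMap τ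
    (fun i => (hτ.isTracialState i).norm_eq_one.le) hτ.compatible
  refine ⟨σ, ⟨⟨fun x => ?_, le_antisymm ?_ ?_, fun x y => ?_⟩, hσ⟩, fun σ' h => ?_⟩
  · refine hμ.dense_iUnion_range.induction (P := fun x => 0 ≤ σ (star x * x)) ?_
      (isClosed_le continuous_const (by fun_prop)) x
    rintro _ ⟨_, ⟨i, rfl⟩, a, rfl⟩
    rw [← map_star, ← map_mul, hσ]
    exact (hτ.isTracialState i).nonneg a
  · exact σ.opNorm_le_bound zero_le_one fun x => (hle x).trans_eq (one_mul _).symm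
  · rw [← (hτ.isTracialState 0).norm_eq_one]
    refine ContinuousLinearMap.opNorm_le_bound _ (norm_nonneg _) fun a => ?_
    rw [← hσ]
    exact (σ.le_opNorm _).trans (mul_le_mul_of_nonneg_left
      (NonUnitalStarAlgHom.norm_apply_le (μ 0) a) (norm_nonneg _))
  · refine forall₂_of_dense_iUnion hμ.monotone_range hμ.monotone_range hμ.dense_iUnion_range
      hμ.dense_iUnion_range (P := fun x y => σ (x * y) = σ (y * x))
      (isClosed_eq (by fun_prop) (by fun_prop)) ?_ x y
    rintro i _ ⟨a, rfl⟩ _ ⟨b, rfl⟩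
    rw [← map_mul, ← map_mul, hσ, hσ]
    exact (hτ.isTracialState i).map_mul_comm a b
  · exact DFunLike.coe_injective (hμ.continuous_ext σ'.continuous σ.continuous
      fun i a => (h.map_eq i a).trans (hσ i a).symm)

end IsInductiveLimit

end InductiveLimit

/-! ### Crossed products -/

theorem continuous_starAlgHom {A B : Type*} [NonUnitalCStarAlgebra A] [NonUnitalCStarAlgebra B]
    (f : A →⋆ₙₐ[ℂ] B) : Continuous f :=
  AddMonoidHomClass.continuous_of_bound f 1 fun x =>
    (NonUnitalStarAlgHom.norm_apply_le f x).trans_eq (one_mul _).symm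

namespace PartialAction

variable {G : Type*} [Group G] {A : Type*} [NonUnitalCStarAlgebra A] {α : PartialAction G A}

theorem continuous_map (g : G) : Continuous (α.map g) := by
  have := α.isClosed_dom g
  have := α.isClosed_dom g⁻¹
  exact AddMonoidHomClass.continuous_of_bound (α.map g) 1 fun x =>
    (NonUnitalStarAlgHom.norm_apply_le (α.map g) x).trans_eq (one_mul _).symm

theorem continuous_act_comp {X : Type*} [TopologicalSpace X] {f : X → A} (hf : Continuous f)
    {g : G} (hmem : ∀ x, f x ∈ α.dom g⁻¹) : Continuous fun x => α.act g (f x) := by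
  have h : (fun x => α.act g (f x)) = fun x => (α.map g ⟨f x, hmem x⟩ : A) :=
    funext fun x => α.act_of_mem (hmem x)
  rw [h]
  exact continuous_subtype_val.comp ((continuous_map g).comp (hf.subtype_mk hmem))

namespace AlgCrossedProduct

theorem continuous_fiberMul (g h : G) :
    Continuous fun z : α.dom g × α.dom h => fiberMul α g h z.1 z.2 := by
  refine Continuous.subtype_mk (continuous_act_comp (Continuous.mul ?_ (by fun_prop)) fun z =>
    α.mul_mem_right _ _ (α.act_mem _ _)) _
  exact continuous_act_comp (by fun_prop) fun z => α.mem_inv_inv z.1.2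

theorem continuous_fiberStar (g : G) : Continuous (fiberStar α g) :=
  Continuous.subtype_mk (continuous_act_comp (continuous_subtype_val.star) fun a =>
    α.mem_inv_inv (star_mem a.2)) _

/-- The ⋆-homomorphism `∑ a_g δ_g ↦ ∑ f_g(a_g)` given by linear maps `f_g` that respect the products
and involutions of the fibres. -/
noncomputable def liftHom {B : Type*} [NonUnitalCStarAlgebra B] (f : ∀ g, α.dom g →ₗ[ℂ] B)
    (hmul : ∀ g h a b, f (g * h) (fiberMul α g h a b) = f g a * f h b)
    (hstar : ∀ g a, f g⁻¹ (fiberStar α g a) = star (f g a)) :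
    α.AlgCrossedProduct →⋆ₙₐ[ℂ] B where
  toFun := lift α f
  map_smul' := map_smul (lift α f)
  map_zero' := map_zero (lift α f)
  map_add' := map_add (lift α f)
  map_mul' x y := by
    induction x using AlgCrossedProduct.induction with
    | h0 => simp only [zero_mul, map_zero]
    | hadd x x' hx hx' => simp only [add_mul, map_add, hx, hx']
    | hδ g a =>
      induction y using AlgCrossedProduct.induction with
      | h0 => simp only [mul_zero, map_zero]
      | hadd y y' hy hy' => simp only [mul_add, map_add, hy, hy']
      | hδ h b => simp only [δ_mul_δ, lift_δ, hmul]
  map_star' x := by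
    induction x using AlgCrossedProduct.induction with
    | h0 => simp only [star_zero, map_zero]
    | hadd x y hx hy => simp only [star_add, map_add, hx, hy]
    | hδ g a => simp only [star_δ, lift_δ, hstar]

/-- The C⋆-seminorm `x ↦ ‖f(x)‖` of a ⋆-homomorphism to a C⋆-algebra. -/
noncomputable def homSeminorm {B : Type*} [NonUnitalCStarAlgebra B]
    (f : α.AlgCrossedProduct →⋆ₙₐ[ℂ] B) : CStarSeminorm α.AlgCrossedProduct where
  toSeminorm := (normSeminorm ℂ B).comp (LinearMapClass.linearMap f)
  mul_le' x y := by
    change ‖f (x * y)‖ ≤ ‖f x‖ * ‖f y‖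
    rw [map_mul]
    exact norm_mul_le _ _
  star_eq' x := by
    change ‖f (star x)‖ = ‖f x‖
    rw [map_star, norm_star]
  star_mul_self_eq' x := by
    change ‖f (star x * x)‖ = ‖f x‖ ^ 2
    rw [map_mul, map_star, CStarRing.norm_star_mul_self, sq]

/-- The only products of homogeneous elements with a nonzero coefficient at `e` are those of
`a δ_g` and `b δ_{g⁻¹}`; invariance of `τ` moves `α_g(α_{g⁻¹}(a) b)` to `α_{g⁻¹}(a) b`. -/
theorem trace_coeffOne_mul_comm {τ : A →L[ℂ] ℂ} (hτ : ∀ a b, τ (a * b) = τ (b * a))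
    (hinv : α.IsInvariant τ) (x y : α.AlgCrossedProduct) :
    τ (coeffOne α (x * y)) = τ (coeffOne α (y * x)) := by
  induction x using AlgCrossedProduct.induction with
  | h0 => simp only [zero_mul, mul_zero]
  | hadd x x' hx hx' => simp only [add_mul, mul_add, map_add, hx, hx']
  | hδ g a =>
    induction y using AlgCrossedProduct.induction with
    | h0 => simp only [zero_mul, mul_zero]
    | hadd y y' hy hy' => simp only [add_mul, mul_add, map_add, hy, hy']
    | hδ h b =>
      rw [δ_mul_δ, δ_mul_δ, coeffOne_δ, coeffOne_δ]
      by_cases hgh : g * h = 1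
      · obtain rfl : h = g⁻¹ := eq_inv_of_mul_eq_one_right hgh
        have hb : (b : A) ∈ α.dom g⁻¹ := b.2
        have h1 : α.act g⁻¹ (a : A) * b ∈ α.dom g⁻¹ := α.mul_mem_left _ _ hb
        have h2 : α.act g⁻¹ (α.act g b * a) = b * α.act g⁻¹ a := by
          rw [α.act_mul (α.mem_inv_inv (α.act_mem g _)) (α.mem_inv_inv a.2), α.act_inv_act hb]
        rw [if_pos (mul_inv_cancel g), if_pos (inv_mul_cancel g), coe_fiberMul, coe_fiberMul,
          inv_inv, h2, hinv g _ (α.act_mem g _), ← α.act_of_mem, α.act_inv_act h1, hτ]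
      · rw [if_neg hgh, if_neg fun h' => hgh (mul_eq_one_comm.mp h')]

end AlgCrossedProduct

namespace CrossedProduct

open AlgCrossedProduct in
theorem condExp_ofAlg (x : α.AlgCrossedProduct) : condExp α (ofAlg α x) = coeffOne α x :=
  (maxSeminorm α).extendL_toCompl (coeffOne α) norm_coeffOne_le x

/-- A continuous additive property of a crossed product can be checked on the `a δ_g`. -/
theorem induction_δ {P : α.CrossedProduct → Prop} (hP : IsClosed {x | P x}) (h0 : P 0)
    (hadd : ∀ x y, P x → P y → P (x + y)) (hδ : ∀ g a, P (δ α g a)) (x : α.CrossedProduct) :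
    P x := by
  refine (denseRange_ofAlg α).induction_on x hP fun y => ?_
  induction y using AlgCrossedProduct.induction with
  | h0 => rwa [map_zero]
  | hadd y y' hy hy' => rw [map_add]; exact hadd _ _ hy hy'
  | hδ g a => exact hδ g a

theorem ext_δ {F M : Type*} [NormedAddCommGroup M] [FunLike F α.CrossedProduct M]
    [AddMonoidHomClass F α.CrossedProduct M] {f f' : F} (hf : Continuous f) (hf' : Continuous f')
    (h : ∀ g a, f (δ α g a) = f' (δ α g a)) (x : α.CrossedProduct) : f x = f' x := by
  refine induction_δ (isClosed_eq hf hf') ?_ (fun x y hx hy => ?_) h x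
  · rw [map_zero, map_zero]
  · rw [map_add, map_add, hx, hy]

theorem norm_condExp_le (x : α.CrossedProduct) : ‖condExp α x‖ ≤ ‖x‖ := by
  refine (denseRange_ofAlg α).induction_on x
    (isClosed_le (condExp α).continuous.norm continuous_norm) fun y => ?_
  rw [condExp_ofAlg]
  exact (AlgCrossedProduct.norm_coeffOne_le y).trans_eq
    ((AlgCrossedProduct.maxSeminorm α).norm_toCompl y).symm

variable (α) in
/-- The embedding `a ↦ a δ_e` of `A` into the crossed product. -/
noncomputable def incl : A →⋆ₙₐ[ℂ] α.CrossedProduct := (ofAlg α).comp (AlgCrossedProduct.ι α)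

theorem condExp_incl (a : A) : condExp α (incl α a) = a :=
  (condExp_ofAlg _).trans (AlgCrossedProduct.coeffOne_ι a)

theorem δ_mul_star_δ (g : G) (a : α.dom g) :
    δ α g a * star (δ α g a) = incl α ((a : A) * star (a : A)) := by
  rw [δ, ← map_star, ← map_mul, AlgCrossedProduct.δ_mul_star_δ]
  rfl

theorem norm_δ_le (g : G) (a : α.dom g) : ‖δ α g a‖ ≤ ‖(a : A)‖ := by
  refine le_of_sq_le_sq ?_ (norm_nonneg _)
  rw [sq, ← CStarRing.norm_self_mul_star, δ_mul_star_δ, sq, ← CStarRing.norm_self_mul_star]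
  exact NonUnitalStarAlgHom.norm_apply_le _ _

theorem continuous_δ (g : G) : Continuous (δ α g) :=
  AddMonoidHomClass.continuous_of_bound ((LinearMapClass.linearMap (ofAlg α) :
    α.AlgCrossedProduct →ₗ[ℂ] α.CrossedProduct) ∘ₗ AlgCrossedProduct.δ α g) 1 fun a =>
      (norm_δ_le g a).trans_eq (one_mul _).symm

theorem map_incl {B : Type*} [NonUnitalCStarAlgebra B] {β : PartialAction G B} {φ : A →⋆ₙₐ[ℂ] B}
    (hφ : α.IsEquivariant β φ) (a : A) : map hφ (incl α a) = incl β (φ a) :=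
  map_δ hφ 1 ⟨a, α.mem_dom_one a⟩

theorem condExp_map {B : Type*} [NonUnitalCStarAlgebra B] {β : PartialAction G B}
    {φ : A →⋆ₙₐ[ℂ] B} (hφ : α.IsEquivariant β φ) (x : α.CrossedProduct) :
    condExp β (map hφ x) = φ (condExp α x) := by
  refine induction_δ (P := fun x => condExp β (map hφ x) = φ (condExp α x))
    (isClosed_eq ((condExp β).continuous.comp (continuous_starAlgHom _))
    ((continuous_starAlgHom φ).comp (condExp α).continuous)) ?_ (fun x y hx hy => ?_) (fun g a => ?_) x
  · simp only [map_zero]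
  · simp only [map_add, hx, hy]
  · rw [map_δ, condExp_δ, condExp_δ]
    split_ifs
    · rfl
    · rw [map_zero]

open scoped ComplexOrder in
/-- The positivity comes from `E(x* x) = ∑ y_g y_g*`, where `x* = ∑ y_g δ_g`. -/
theorem isTracialState_comp_condExp {τ : A →L[ℂ] ℂ} (hτ : IsTracialState τ)
    (hinv : α.IsInvariant τ) : IsTracialState (τ.comp (condExp α)) where
  nonneg x := by
    refine (denseRange_ofAlg α).induction_on (p := fun x => 0 ≤ τ (condExp α (star x * x))) x
      (isClosed_le continuous_const (by fun_prop)) fun y => ?_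
    obtain ⟨s, hs, -⟩ := AlgCrossedProduct.coeffOne_mul_star (star y)
    rw [← map_star, ← map_mul, condExp_ofAlg]
    rw [star_star] at hs
    rw [hs, map_sum]
    refine Finset.sum_nonneg fun g _ => ?_
    rw [hτ.map_mul_comm]
    exact hτ.nonneg _
  norm_eq_one := by
    refine le_antisymm ?_ ?_
    · refine ContinuousLinearMap.opNorm_le_bound _ zero_le_one fun x => ?_
      rw [← hτ.norm_eq_one]
      exact (τ.le_opNorm _).trans (mul_le_mul_of_nonneg_left (norm_condExp_le x) (norm_nonneg _))
    · conv_lhs => rw [← hτ.norm_eq_one]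
      refine ContinuousLinearMap.opNorm_le_bound _ (norm_nonneg _) fun a => ?_
      have h := (τ.comp (condExp α)).le_opNorm (incl α a)
      rw [ContinuousLinearMap.comp_apply, condExp_incl] at h
      exact h.trans (mul_le_mul_of_nonneg_left
        (NonUnitalStarAlgHom.norm_apply_le (incl α) a) (norm_nonneg _))
  map_mul_comm x y := by
    refine (denseRange_ofAlg α).induction_on₂
      (p := fun x y => τ (condExp α (x * y)) = τ (condExp α (y * x)))
      (isClosed_eq (by fun_prop) (by fun_prop)) (fun x y => ?_) x y
    rw [← map_mul, ← map_mul, condExp_ofAlg, condExp_ofAlg]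
    exact AlgCrossedProduct.trace_coeffOne_mul_comm hτ.map_mul_comm hinv x y

end CrossedProduct

end PartialAction

/-! ### Crossed products of inductive limits -/

namespace IsInductiveLimitAction

open PartialAction

variable {G : Type v} [Group G] {A : ℕ → Type u} [∀ i, NonUnitalCStarAlgebra (A i)]
  {φ : ∀ i, A i →⋆ₙₐ[ℂ] A (i + 1)} {α : ∀ i, PartialAction G (A i)}
  {L : Type u} [NonUnitalCStarAlgebra L] {μ : ∀ i, A i →⋆ₙₐ[ℂ] L} {β : PartialAction G L}

/-- The map `A_{i,g} → L_g` induced by `μ_i`. -/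
def domMap (hβ : IsInductiveLimitAction α μ β) (g : G) (i : ℕ) : (α i).dom g →ₗ[ℂ] β.dom g where
  toFun a := ⟨μ i a, (hβ.equivariant i).map_mem g a.2⟩
  map_add' a b := Subtype.ext (map_add (μ i) (a : A i) (b : A i))
  map_smul' c a := Subtype.ext (map_smul (μ i) c (a : A i))

theorem dense_iUnion_range_domMap (hβ : IsInductiveLimitAction α μ β) (g : G) :
    Dense (⋃ i, Set.range (hβ.domMap g i)) := by
  intro x
  rw [Topology.IsInducing.subtypeVal.closure_eq_preimage_closure_image, Set.mem_preimage]
  have hx : (x : L) ∈ (β.dom g : Set L) := x.2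
  rw [hβ.dom_eq g] at hx
  refine closure_mono ?_ hx
  rintro _ ⟨_, ⟨i, rfl⟩, a, ha, rfl⟩
  exact ⟨hβ.domMap g i ⟨a, ha⟩, Set.mem_iUnion.mpr ⟨i, ⟨a, ha⟩, rfl⟩, rfl⟩

theorem domMap_map (hβ : IsInductiveLimitAction α μ β)
    (hφ : ∀ i, (α i).IsEquivariant (α (i + 1)) (φ i)) (hμ : IsInductiveLimit φ μ) (g : G) (i : ℕ)
    (a : (α i).dom g) :
    hβ.domMap g (i + 1) ⟨φ i a, (hφ i).map_mem g a.2⟩ = hβ.domMap g i a :=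
  Subtype.ext (hμ.map_apply i a)

theorem map_δ_domMap (hβ : IsInductiveLimitAction α μ β) (g : G) (i : ℕ) (a : (α i).dom g) :
    CrossedProduct.map (hβ.equivariant i) (CrossedProduct.δ (α i) g a) =
      CrossedProduct.δ β g (hβ.domMap g i a) :=
  CrossedProduct.map_δ _ g a

theorem domMap_fiberMul (hβ : IsInductiveLimitAction α μ β) (g h : G) (i : ℕ) (a : (α i).dom g)
    (b : (α i).dom h) : hβ.domMap (g * h) i (AlgCrossedProduct.fiberMul (α i) g h a b) =
      AlgCrossedProduct.fiberMul β g h (hβ.domMap g i a) (hβ.domMap h i b) := by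
  refine Subtype.ext ?_
  change μ i ((α i).act g ((α i).act g⁻¹ a * b)) = β.act g (β.act g⁻¹ (μ i a) * μ i b)
  rw [(hβ.equivariant i).map_act ((α i).mul_mem_right _ _ ((α i).act_mem _ _)), map_mul,
    (hβ.equivariant i).map_act ((α i).mem_inv_inv a.2)]

theorem domMap_fiberStar (hβ : IsInductiveLimitAction α μ β) (g : G) (i : ℕ) (a : (α i).dom g) :
    hβ.domMap g⁻¹ i (AlgCrossedProduct.fiberStar (α i) g a) =
      AlgCrossedProduct.fiberStar β g (hβ.domMap g i a) := by
  refine Subtype.ext ?_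
  change μ i ((α i).act g⁻¹ (star (a : A i))) = β.act g⁻¹ (star (μ i a))
  rw [(hβ.equivariant i).map_act ((α i).mem_inv_inv (star_mem a.2)), map_star]

/-- For ⋆-homomorphisms `ν_i` on the crossed products that form a compatible family,
`‖ν_i(a δ_g)‖ ≤ ‖μ_i(a)‖`: by the C⋆-identity it suffices to consider `a a* δ_e`, where this is the
maximality of the norm on the inductive limit `L`. -/
theorem norm_apply_δ_le (hμ : IsInductiveLimit φ μ)
    (hφ : ∀ i, (α i).IsEquivariant (α (i + 1)) (φ i)) {B : Type*} [NonUnitalCStarAlgebra B]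
    {ν : ∀ i, (α i).CrossedProduct →⋆ₙₐ[ℂ] B}
    (hν : ∀ i x, ν (i + 1) (CrossedProduct.map (hφ i) x) = ν i x) (g : G) (i : ℕ)
    (a : (α i).dom g) : ‖ν i (CrossedProduct.δ (α i) g a)‖ ≤ ‖μ i a‖ := by
  have key : ∀ b : A i, ‖ν i (CrossedProduct.incl (α i) b)‖ ≤ ‖μ i b‖ :=
    hμ.le_norm_of_compatible (fun i b => ‖ν i (CrossedProduct.incl (α i) b)‖)
      (fun i b => NonUnitalStarAlgHom.norm_apply_le ((ν i).comp (CrossedProduct.incl (α i))) b)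
      (fun i b => by rw [← CrossedProduct.map_incl (hφ i), hν]) i
  refine le_of_sq_le_sq ?_ (norm_nonneg _)
  rw [sq, ← CStarRing.norm_self_mul_star, ← map_star, ← map_mul, CrossedProduct.δ_mul_star_δ, sq,
    ← CStarRing.norm_self_mul_star, ← map_star, ← map_mul]
  exact key _

/-- The crossed product of an inductive limit is the inductive limit of the crossed products. A
compatible family `ν_i` is extended fibrewise: `μ_i(a) ↦ ν_i(a δ_g)` is contractive on a dense part
of `L_g`, and its extensions to the `L_g` assemble to a ⋆-homomorphism on the formal sums, which is
automatically bounded by the maximal norm. -/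
theorem isInductiveLimit_crossedProduct (hβ : IsInductiveLimitAction α μ β)
    (hφ : ∀ i, (α i).IsEquivariant (α (i + 1)) (φ i)) (hμ : IsInductiveLimit φ μ) :
    IsInductiveLimit (fun i => CrossedProduct.map (hφ i))
      (fun i => CrossedProduct.map (hβ.equivariant i)) where
  compatible i := by
    ext x
    refine CrossedProduct.ext_δ (f := (CrossedProduct.map (hβ.equivariant (i + 1))).comp
      (CrossedProduct.map (hφ i))) (f' := CrossedProduct.map (hβ.equivariant i))
      (continuous_starAlgHom _) (continuous_starAlgHom _) (fun g a => ?_) x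
    rw [NonUnitalStarAlgHom.comp_apply, CrossedProduct.map_δ, hβ.map_δ_domMap, hβ.map_δ_domMap,
      hβ.domMap_map hφ hμ]
  existsUnique_desc B _ ν hν := by
    have hν' : ∀ i x, ν (i + 1) (CrossedProduct.map (hφ i) x) = ν i x :=
      fun i x => DFunLike.congr_fun (hν i) x
    have hfib : ∀ g : G, ∃ F : β.dom g →L[ℂ] B,
        ∀ i (a : (α i).dom g), F (hβ.domMap g i a) = ν i (CrossedProduct.δ (α i) g a) := fun g => by
      obtain ⟨F, hF, -⟩ := exists_continuousLinearMap_of_dense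
        (fun i (a : (α i).dom g) => (⟨φ i a, (hφ i).map_mem g a.2⟩ : (α (i + 1)).dom g))
        (hβ.domMap g) (fun i => (LinearMapClass.linearMap
          ((ν i).comp (CrossedProduct.ofAlg (α i)))) ∘ₗ AlgCrossedProduct.δ (α i) g)
        (hβ.domMap_map hφ hμ g)
        (fun i a => by
          change ν (i + 1) (CrossedProduct.δ (α (i + 1)) g _) = ν i (CrossedProduct.δ (α i) g a)
          rw [← hν' i, CrossedProduct.map_δ])
        (hβ.dense_iUnion_range_domMap g) (fun i a => norm_apply_δ_le hμ hφ hν' g i a)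
      exact ⟨F, hF⟩
    choose F hF using hfib
    have hmono : ∀ g, Monotone fun i => Set.range (hβ.domMap g i) := fun g =>
      monotone_range_of_compatible (hβ.domMap_map hφ hμ g)
    let Θ : β.AlgCrossedProduct →⋆ₙₐ[ℂ] B := AlgCrossedProduct.liftHom (fun g => (F g).toLinearMap)
      (fun g h => by
        refine forall₂_of_dense_iUnion (hmono g) (hmono h) (hβ.dense_iUnion_range_domMap g)
          (hβ.dense_iUnion_range_domMap h)
          (P := fun a b => F (g * h) (AlgCrossedProduct.fiberMul β g h a b) = F g a * F h b)
          (isClosed_eq ((F _).continuous.comp (AlgCrossedProduct.continuous_fiberMul g h))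
            (by fun_prop)) ?_
        rintro i _ ⟨a, rfl⟩ _ ⟨b, rfl⟩
        rw [← domMap_fiberMul, hF, hF, hF, ← map_mul, CrossedProduct.δ, CrossedProduct.δ,
          CrossedProduct.δ, ← map_mul, AlgCrossedProduct.δ_mul_δ])
      (fun g a => by
        refine (hβ.dense_iUnion_range_domMap g).induction
          (P := fun a => F g⁻¹ (AlgCrossedProduct.fiberStar β g a) = star (F g a)) ?_
          (isClosed_eq ((F _).continuous.comp (AlgCrossedProduct.continuous_fiberStar g))
            (by fun_prop)) a
        rintro _ ⟨_, ⟨i, rfl⟩, a, rfl⟩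
        rw [← domMap_fiberStar, hF, hF, ← map_star, CrossedProduct.δ, CrossedProduct.δ,
          ← map_star, AlgCrossedProduct.star_δ])
    let θ : β.CrossedProduct →⋆ₙₐ[ℂ] B := (AlgCrossedProduct.maxSeminorm β).extend Θ
      (AlgCrossedProduct.le_maxSeminorm (AlgCrossedProduct.homSeminorm Θ))
    have hθ : ∀ g a, θ (CrossedProduct.δ β g a) = F g a := fun g a =>
      ((AlgCrossedProduct.maxSeminorm β).extend_toCompl _ _ _).trans
        (AlgCrossedProduct.lift_δ (fun g => (F g).toLinearMap) g a)
    refine ⟨θ, fun i => ?_, fun θ' hθ' => ?_⟩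
    · ext x
      refine CrossedProduct.ext_δ (f := θ.comp (CrossedProduct.map (hβ.equivariant i)))
        (f' := ν i) (continuous_starAlgHom _) (continuous_starAlgHom _)
        (fun g a => ?_) x
      rw [NonUnitalStarAlgHom.comp_apply, hβ.map_δ_domMap, hθ, hF]
    · ext x
      refine CrossedProduct.ext_δ (f := θ') (f' := θ) (continuous_starAlgHom _)
        (continuous_starAlgHom _) (fun g a => ?_) x
      rw [hθ]
      refine (hβ.dense_iUnion_range_domMap g).induction
        (P := fun a => θ' (CrossedProduct.δ β g a) = F g a) ?_
        (isClosed_eq ((continuous_starAlgHom θ').comp (CrossedProduct.continuous_δ g))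
          (F g).continuous) a
      rintro _ ⟨_, ⟨i, rfl⟩, a, rfl⟩
      rw [hF, ← hβ.map_δ_domMap]
      exact DFunLike.congr_fun (hθ' i) _

end IsInductiveLimitAction

/-! ### Limit traces on crossed products -/

theorem proposition4p10
    {G : Type v} [Group G]
    -- an inductive sequence of partial dynamical systems
    {A : ℕ → Type u} [∀ i, NonUnitalCStarAlgebra (A i)]
    (φ : ∀ i, A i →⋆ₙₐ[ℂ] A (i + 1))
    (α : ∀ i, PartialAction G (A i))
    (hφ : ∀ i, (α i).IsEquivariant (α (i + 1)) (φ i))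
    -- its inductive limit partial dynamical system
    {L : Type u} [NonUnitalCStarAlgebra L]
    (μ : ∀ i, A i →⋆ₙₐ[ℂ] L) (hμ : IsInductiveLimit φ μ)
    (β : PartialAction G L) (hβ : IsInductiveLimitAction α μ β)
    -- a `G`-invariant inductive sequence of tracial states
    (τ : ∀ i, A i →L[ℂ] ℂ) (hτ : IsTracialSequence φ τ)
    (hinv : ∀ i, (α i).IsInvariant (τ i)) :
    -- the crossed product of the limit is the limit of the crossed products
    IsInductiveLimit (fun i => PartialAction.CrossedProduct.map (hφ i))
      (fun i => PartialAction.CrossedProduct.map (hβ.equivariant i)) ∧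
    -- the `τ_i ∘ E_i` form an inductive sequence of tracial states
    IsTracialSequence (fun i => PartialAction.CrossedProduct.map (hφ i))
      (fun i => (τ i).comp (PartialAction.CrossedProduct.condExp (α i))) ∧
    -- both limit traces exist and are unique
    (∃! σ : L →L[ℂ] ℂ, IsLimitTrace μ τ σ) ∧
    (∃! T : β.CrossedProduct →L[ℂ] ℂ,
      IsLimitTrace (fun i => PartialAction.CrossedProduct.map (hβ.equivariant i))
        (fun i => (τ i).comp (PartialAction.CrossedProduct.condExp (α i))) T) ∧
    -- `(lim τ_i) ∘ E = lim (τ_i ∘ E_i)`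
    ∀ (σ : L →L[ℂ] ℂ) (T : β.CrossedProduct →L[ℂ] ℂ),
      IsLimitTrace μ τ σ →
      IsLimitTrace (fun i => PartialAction.CrossedProduct.map (hβ.equivariant i))
        (fun i => (τ i).comp (PartialAction.CrossedProduct.condExp (α i))) T →
      σ.comp (PartialAction.CrossedProduct.condExp β) = T := by
  have hlim := hβ.isInductiveLimit_crossedProduct hφ hμ
  have hseq : IsTracialSequence (fun i => PartialAction.CrossedProduct.map (hφ i))
      (fun i => (τ i).comp (PartialAction.CrossedProduct.condExp (α i))) :=
    ⟨fun i => PartialAction.CrossedProduct.isTracialState_comp_condExp (hτ.isTracialState i)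
      (hinv i), fun i x => by
        rw [ContinuousLinearMap.comp_apply, PartialAction.CrossedProduct.condExp_map,
          hτ.compatible]
        rfl⟩
  refine ⟨hlim, hseq, hμ.existsUnique_isLimitTrace hτ, hlim.existsUnique_isLimitTrace hseq,
    fun σ T hσ hT => ?_⟩
  refine DFunLike.coe_injective (hlim.continuous_ext (ContinuousLinearMap.continuous _)
    T.continuous fun i x => ?_)
  rw [hT.map_eq, ContinuousLinearMap.comp_apply, PartialAction.CrossedProduct.condExp_map,
    hσ.map_eq]
  rfl
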